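/- Let $\mathbf{M}$ be a complete and cocomplete closed symmetric monoidal category with tensor product $\otimes$ and unit $I$. Let $\mathcal{P}$ be a (symmetric, unital) single-colored operad with values in $\mathbf{M}$, with category of algebras $\mathbf{Alg}_{\mathcal{P}}$, and let $r_1,r_2 : I\to\mathcal{P}(2)$ be two chosen operations of arity $2$. An orthogonality relation on a small category $\mathbf{C}$ is a set $\perp$ of pairs of morphisms with common target that is symmetric and such that $f_1\perp f_2$ implies $g f_1 h_1\perp g f_2 h_2$ for all composable $g,h_1,h_2$; the pair $\overline{\mathbf{C}}=(\mathbf{C},\perp)$ is called an orthogonal category. A field theory of type $\mathcal{P}^{(r_1,r_2)}$ on $\overline{\mathbf{C}}$ is a functor $\mathfrak{A}:\mathbf{C}\to\mathbf{Alg}_{\mathcal{P}}$ such that for all $(f_1:c_1\to c)\perp(f_2:c_2\to c)$ the two composites $$I\otimes\mathfrak{A}(c_1)\otimes\mathfrak{A}(c_2)\xrightarrow{\;r_i\otimes\mathfrak{A}(f_1)\otimes\mathfrak{A}(f_2)\;}\mathcal{P}(2)\otimes\mathfrak{A}(c)^{\otimes 2}\longrightarrow\mathfrak{A}(c),\qquad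 i=1,2,$$ where the second arrow is the $\mathcal{P}$-action, coincide. Field theories form a full subcategory $\mathbf{FT}(\overline{\mathbf{C}},\mathcal{P}^{(r_1,r_2)})$ of the functor category $\mathbf{Alg}_{\mathcal{P}}^{\mathbf{C}}$. Let $\overline{\mathbf{C}}=(\mathbf{C},\perp)$ be an orthogonal category, let $W$ be a set of morphisms of $\mathbf{C}$, and let $L:\mathbf{C}\to\mathbf{C}[W^{-1}]$ be a localization of $\mathbf{C}$ at $W$, with $\mathbf{C}[W^{-1}]$ small. Equip $\mathbf{C}[W^{-1}]$ with the smallest orthogonality relation such that $L(f_1)\perp L(f_2)$ whenever $f_1\perp f_2$ in $\mathbf{C}$; this gives the orthogonal localization $\overline{\mathbf{C}[W^{-1}]}$. A field theory $\mathfrak{A}$ on $\overline{\mathbf{C}}$ is called $W$-constant if $\mathfrak{A}(f)$ is an isomorphism for every $f\in W$; let $\mathbf{FT}(\overline{\mathbf{C}},\mathcal{P}^{(r_1,r_2)})^{W\text{-const}}$ be the full subcategory of $W$-constant field theories. Then the pullback functor $L^*=(-)\circ L:\mathbf{FT}(\overline{\mathbf{C}[W^{-1}]},\mathcal{P}^{(r_1,r_2)})\to\mathbf{FT}(\overline{\mathbf{C}},\mathcal{P}^{(r_1,r_2)})$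 takes values in $W$-constant field theories and has a left adjoint $L_!$. For every such adjunction $L_!\dashv L^*$, with unit $\eta$: 1. the adjunction restricts to an adjoint equivalence $$L_!:\mathbf{FT}(\overline{\mathbf{C}},\mathcal{P}^{(r_1,r_2)})^{W\text{-const}}\;\rightleftarrows\;\mathbf{FT}(\overline{\mathbf{C}[W^{-1}]},\mathcal{P}^{(r_1,r_2)}):L^*,$$ that is, the unit and the counit of the restricted adjunction are natural isomorphisms; 2. a field theory $\mathfrak{A}\in\mathbf{FT}(\overline{\mathbf{C}},\mathcal{P}^{(r_1,r_2)})$ is $W$-constant if and only if $\eta_{\mathfrak{A}}:\mathfrak{A}\to L^*L_!(\mathfrak{A})$ is an isomorphism. -/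

import Mathlib

open CategoryTheory MonoidalCategory Limits

universe v u

namespace FieldTheory

/-! ### Finite tensor products in a symmetric monoidal category -/

section Tensor

variable {M : Type u} [Category.{v} M] [MonoidalCategory M]

/-- The tensor product `X 0 ⊗ ⋯ ⊗ X (n - 1)` of a finite family, bracketed to the left and
starting with the unit object: `(((𝟙 ⊗ X 0) ⊗ X 1) ⊗ ⋯) ⊗ X (n - 1)`. -/
def tens : {n : ℕ} → (Fin n → M) → M
  | 0, _ => 𝟙_ M
  | _ + 1, X => tens (fun i => X i.castSucc) ⊗ X (Fin.last _)

/-- The tensor product of a finite family of morphisms. -/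
def tensMap : {n : ℕ} → {X Y : Fin n → M} → (∀ i, X i ⟶ Y i) → (tens X ⟶ tens Y)
  | 0, _, _, _ => 𝟙 (𝟙_ M)
  | _ + 1, _, _, f => tensMap (fun i => f i.castSucc) ⊗ₘ f (Fin.last _)

theorem tensMap_id : {n : ℕ} → (X : Fin n → M) → tensMap (fun i => 𝟙 (X i)) = 𝟙 (tens X)
  | 0, _ => rfl
  | _ + 1, X => by
      simp only [tensMap, tensMap_id, id_tensorHom_id]
      rfl

theorem tensMap_comp : {n : ℕ} → {X Y Z : Fin n → M} → (f : ∀ i, X i ⟶ Y i) →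
    (g : ∀ i, Y i ⟶ Z i) → tensMap (fun i => f i ≫ g i) = tensMap f ≫ tensMap g
  | 0, _, _, _, _, _ => (Category.id_comp _).symm
  | _ + 1, _, _, _, f, g => by
      simp only [tensMap, tensMap_comp]
      exact (tensorHom_comp_tensorHom _ _ _ _).symm

/-- Two equal ways of indexing the factors give the same tensor product. -/
def tensCongr {ι : Type} (X : ι → M) {n : ℕ} {p q : Fin n → ι} (h : p = q) :
    tens (fun i => X (p i)) ≅ tens (fun i => X (q i)) :=
  eqToIso (by rw [h])

/-- Transport of a tensor product along an equality of the numbers of factors. -/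
def tensCast {m n : ℕ} (h : m = n) (X : Fin n → M) :
    tens X ≅ tens (fun i : Fin m => X (Fin.cast h i)) :=
  eqToIso (by subst h; rfl)

/-- The reassociation `X₁ ⊗ ⋯ ⊗ X_{m+n} ≅ (X₁ ⊗ ⋯ ⊗ X_m) ⊗ (X_{m+1} ⊗ ⋯ ⊗ X_{m+n})`. -/
def tensAdd (m : ℕ) : (n : ℕ) → (X : Fin (m + n) → M) →
    (tens X ≅ tens (fun i => X (Fin.castAdd n i)) ⊗ tens (fun j => X (Fin.natAdd m j)))
  | 0, X => (ρ_ (tens X)).symm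
  | n + 1, X =>
      whiskerRightIso (tensAdd m n (fun i => X i.castSucc)) (X (Fin.last (m + n))) ≪≫
        α_ _ _ _

/-- The position of the `j`-th element of the `i`-th block, when `{1, …, k₁ + ⋯ + kₙ}` is divided
into consecutive blocks of lengths `k₁, …, kₙ`. -/
def blk {n : ℕ} (k : Fin n → ℕ) (i : Fin n) (j : Fin (k i)) : Fin (∑ i, k i) :=
  finSigmaFinEquiv ⟨i, j⟩

theorem cast_castAdd_blk {n : ℕ} (k : Fin (n + 1) → ℕ) (i : Fin n) (j : Fin (k i.castSucc)) :
    Fin.cast (Fin.sum_univ_castSucc k).symm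
      (Fin.castAdd (k (Fin.last n)) (blk (fun i => k i.castSucc) i j)) = blk k i.castSucc j := by
  ext
  simp only [blk, Fin.val_cast, Fin.val_castAdd, finSigmaFinEquiv_apply]
  rfl

theorem cast_natAdd_blk {n : ℕ} (k : Fin (n + 1) → ℕ) (j : Fin (k (Fin.last n))) :
    Fin.cast (Fin.sum_univ_castSucc k).symm
      (Fin.natAdd (∑ i : Fin n, k i.castSucc) j) = blk k (Fin.last n) j := by
  ext
  simp only [blk, Fin.val_cast, Fin.val_natAdd, finSigmaFinEquiv_apply]
  rfl

/-- The reassociation of a tensor product over `k₁ + ⋯ + kₙ` factors into a tensor product of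
`n` blocks. -/
def tensSigma : {n : ℕ} → (k : Fin n → ℕ) → (X : Fin (∑ i, k i) → M) →
    (tens X ≅ tens (fun i => tens (fun j => X (blk k i j))))
  | 0, k, X => tensCast (m := 0) (by simp) X
  | n + 1, k, X =>
      tensCast (Fin.sum_univ_castSucc k).symm X ≪≫
        tensAdd (∑ i : Fin n, k i.castSucc) (k (Fin.last n)) _ ≪≫
          ((tensSigma (fun i => k i.castSucc) _ ≪≫
              eqToIso (by simp only [cast_castAdd_blk])) ⊗ᵢ
            tensCongr X (funext fun j => cast_natAdd_blk k j))

variable [SymmetricCategory M]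

/-- The canonical isomorphism
`(⨂ᵢ Xᵢ) ⊗ (⨂ᵢ Yᵢ) ≅ ⨂ᵢ (Xᵢ ⊗ Yᵢ)` built from the symmetric braiding. -/
def tensTensor : {n : ℕ} → (X Y : Fin n → M) →
    (tens X ⊗ tens Y ≅ tens (fun i => X i ⊗ Y i))
  | 0, _, _ => λ_ (𝟙_ M)
  | _ + 1, X, Y =>
      { hom := tensorμ _ _ _ _
        inv := tensorδ _ _ _ _
        hom_inv_id := tensorμ_tensorδ _ _ _ _
        inv_hom_id := tensorδ_tensorμ _ _ _ _ : _ ≅ _ } ≪≫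
      whiskerRightIso (tensTensor (fun i => X i.castSucc) (fun i => Y i.castSucc))
        (X (Fin.last _) ⊗ Y (Fin.last _))

/-- Braid the `p`-th factor of a tensor product to the last place, keeping the order of the
other ones. -/
def tensExtract : {n : ℕ} → (X : Fin (n + 1) → M) → (p : Fin (n + 1)) →
    (tens X ≅ tens (fun j => X (p.succAbove j)) ⊗ X p)
  | 0, X, p => eqToIso (by
      obtain rfl : p = Fin.last 0 := Fin.ext (by omega)
      rfl)
  | n + 1, X, p =>
      if h : p = Fin.last (n + 1) then
        eqToIso (by subst h; simp only [Fin.succAbove_last]; rfl)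
      else
        whiskerRightIso (tensExtract (fun i => X i.castSucc) (p.castPred h)) _ ≪≫
          α_ _ _ _ ≪≫ whiskerLeftIso _ (β_ _ _) ≪≫ (α_ _ _ _).symm ≪≫
          eqToIso (by
            obtain ⟨q, rfl⟩ := Fin.exists_castSucc_eq.2 h
            simp only [Fin.castPred_castSucc]
            change _ = (tens (fun j : Fin n => X (q.castSucc.succAbove j.castSucc)) ⊗
              X (q.castSucc.succAbove (Fin.last n))) ⊗ X q.castSucc
            have hl : q.castSucc.succAbove (Fin.last n) = Fin.last (n + 1) :=
              Fin.succAbove_ne_last_last h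
            simp only [Fin.castSucc_succAbove_castSucc, hl])

/-- The permutation of `{1, …, n}` obtained from a permutation `σ` of `{1, …, n + 1}` by deleting
`n + 1` from the domain and `σ (n + 1)` from the codomain, and renumbering monotonically. -/
def permInit {n : ℕ} (σ : Equiv.Perm (Fin (n + 1))) : Equiv.Perm (Fin n) :=
  ((finSuccAboveEquiv (Fin.last n)).trans
    (σ.subtypeEquiv (fun _ => σ.injective.ne_iff.symm))).trans
      (finSuccAboveEquiv (σ (Fin.last n))).symm

theorem succAbove_permInit {n : ℕ} (σ : Equiv.Perm (Fin (n + 1))) (j : Fin n) :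
    (σ (Fin.last n)).succAbove (permInit σ j) = σ j.castSucc := by
  have h := (finSuccAboveEquiv (σ (Fin.last n))).apply_symm_apply
    ⟨σ j.castSucc, σ.injective.ne (Fin.castSucc_lt_last j).ne⟩
  have h' : permInit σ j = (finSuccAboveEquiv (σ (Fin.last n))).symm
      ⟨σ j.castSucc, σ.injective.ne (Fin.castSucc_lt_last j).ne⟩ := by
    simp [permInit, finSuccAboveEquiv_apply]
  rw [h']
  exact congrArg Subtype.val h

/-- The isomorphism `X₁ ⊗ ⋯ ⊗ Xₙ ≅ X_{σ(1)} ⊗ ⋯ ⊗ X_{σ(n)}` given by the symmetric braiding. -/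
def tensPerm : {n : ℕ} → (σ : Equiv.Perm (Fin n)) → (X : Fin n → M) →
    (tens X ≅ tens (fun i => X (σ i)))
  | 0, _, _ => Iso.refl _
  | n + 1, σ, X =>
      tensExtract X (σ (Fin.last n)) ≪≫
        whiskerRightIso
          (tensPerm (permInit σ) (fun j => X ((σ (Fin.last n)).succAbove j)) ≪≫
            tensCongr X (funext fun j => succAbove_permInit σ j))
          (X (σ (Fin.last n)))

/-- The canonical rearrangement
`Q ⊗ ⨂ᵢ (Xᵢ ⊗ ⨂ⱼ Y_{ij}) ≅ (Q ⊗ ⨂ᵢ Xᵢ) ⊗ ⨂_{(i, j)} Y_{ij}`. -/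
def regroup (Q : M) {n : ℕ} (X : Fin n → M) (k : Fin n → ℕ) (Y : Fin (∑ i, k i) → M) :
    Q ⊗ tens (fun i => X i ⊗ tens (fun j => Y (blk k i j))) ≅ (Q ⊗ tens X) ⊗ tens Y :=
  whiskerLeftIso Q
      ((tensTensor X (fun i => tens (fun j => Y (blk k i j)))).symm ≪≫
        whiskerLeftIso _ (tensSigma k Y).symm) ≪≫
    (α_ _ _ _).symm

/-- The isomorphism `𝟙 ⊗ ⋯ ⊗ 𝟙 ≅ 𝟙`. -/
def tensUnit : (n : ℕ) → (tens (fun _ : Fin n => 𝟙_ M) ≅ 𝟙_ M)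
  | 0 => Iso.refl _
  | n + 1 => ρ_ _ ≪≫ tensUnit n

end Tensor

/-! ### Operads and their algebras -/

/-- The block permutation `{1, …, k_{σ(1)} + ⋯ + k_{σ(n)}} ≃ {1, …, k₁ + ⋯ + kₙ}` which maps the
`i`-th block of the source monotonically onto the `σ(i)`-th block of the target. -/
def blockPerm {n : ℕ} (σ : Equiv.Perm (Fin n)) (k : Fin n → ℕ) :
    Fin (∑ i, k (σ i)) ≃ Fin (∑ i, k i) :=
  (finSigmaFinEquiv.symm.trans (Equiv.sigmaCongrLeft (β := fun i => Fin (k i)) σ)).trans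
    finSigmaFinEquiv

/-- The sum `τ₁ ⊕ ⋯ ⊕ τₙ` of permutations, which acts on the `i`-th block through `τᵢ`. -/
def sumPerm {n : ℕ} (k : Fin n → ℕ) (τ : ∀ i, Equiv.Perm (Fin (k i))) :
    Equiv.Perm (Fin (∑ i, k i)) :=
  (finSigmaFinEquiv.symm.trans (Equiv.sigmaCongrRight τ)).trans finSigmaFinEquiv

/-- Nested sums have the same value as the sum over all blocks. -/
theorem sum_blk {n : ℕ} (k : Fin n → ℕ) (l : Fin (∑ i, k i) → ℕ) :
    ∑ i, ∑ j, l (blk k i j) = ∑ s, l s := by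
  rw [← Equiv.sum_comp finSigmaFinEquiv l, Fintype.sum_sigma]
  rfl

/-- A (symmetric, unital) single-colored operad with values in a symmetric monoidal category.

The action of the symmetric groups is given as a functorial contravariant action of the
bijections `Fin m ≃ Fin n`. Such bijections exist only for `m = n`, so that this is nothing but a
right action `μ ↦ μσ` of every `Σₙ` on `𝒫(n)`; the form chosen allows to use (block) permutations
between index sets whose cardinalities are equal, but not definitionally so. In particular
`act (finCongr h)` is the identification `𝒫(n) = 𝒫(m)` along `h : m = n`. -/
structure Operad (M : Type u) [Category.{v} M] [MonoidalCategory M] [SymmetricCategory M] where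
  /-- the object `𝒫(n)` of operations of arity `n` -/
  op : ℕ → M
  /-- the permutation action -/
  act : ∀ {m n : ℕ}, (Fin m ≃ Fin n) → (op n ⟶ op m)
  /-- the operadic composition `𝒫(n) ⊗ 𝒫(k₁) ⊗ ⋯ ⊗ 𝒫(kₙ) ⟶ 𝒫(k₁ + ⋯ + kₙ)` -/
  comp : ∀ {n : ℕ} (k : Fin n → ℕ), op n ⊗ tens (fun i => op (k i)) ⟶ op (∑ i, k i)
  /-- the operadic unit -/
  one : 𝟙_ M ⟶ op 1
  act_refl : ∀ n, act (Equiv.refl (Fin n)) = 𝟙 (op n)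
  act_trans : ∀ {l m n : ℕ} (e : Fin l ≃ Fin m) (f : Fin m ≃ Fin n),
    act (e.trans f) = act f ≫ act e
  /-- equivariance in the outer operation -/
  comp_perm : ∀ {n : ℕ} (σ : Equiv.Perm (Fin n)) (k : Fin n → ℕ),
    (act σ ⊗ₘ (tensPerm σ (fun i => op (k i))).hom) ≫ comp (fun i => k (σ i)) =
      comp k ≫ act (blockPerm σ k)
  /-- equivariance in the inner operations -/
  comp_sumPerm : ∀ {n : ℕ} (k : Fin n → ℕ) (τ : ∀ i, Equiv.Perm (Fin (k i))),
    (op n ◁ tensMap (fun i => act (τ i))) ≫ comp k = comp k ≫ act (sumPerm k τ)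
  /-- associativity -/
  comp_assoc : ∀ {n : ℕ} (k : Fin n → ℕ) (l : Fin (∑ i, k i) → ℕ),
    (op n ◁ tensMap (fun i => comp (fun j => l (blk k i j)))) ≫
        comp (fun i => ∑ j, l (blk k i j)) =
      (regroup (op n) (fun i => op (k i)) k (fun s => op (l s))).hom ≫
        (comp k ▷ tens (fun s => op (l s))) ≫ comp l ≫ act (finCongr (sum_blk k l))
  /-- left unitality -/
  one_comp : ∀ n : ℕ,
    (one ⊗ₘ (λ_ (op n)).inv) ≫ comp (fun _ : Fin 1 => n) =
      (λ_ (op n)).hom ≫ act (finCongr (Fin.sum_const 1 n |>.trans (one_smul ℕ n)))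
  /-- right unitality -/
  comp_one : ∀ n : ℕ,
    (op n ◁ ((tensUnit n).inv ≫ tensMap (fun _ => one))) ≫ comp (fun _ : Fin n => 1) =
      (ρ_ (op n)).hom ≫ act (finCongr (Fin.sum_const n 1 |>.trans (mul_one n)))

section Algebra

variable {M : Type u} [Category.{v} M] [MonoidalCategory M] [SymmetricCategory M]

/-- The tensor power `X^{⊗ n}`. -/
abbrev tpow (X : M) (n : ℕ) : M := tens (fun _ : Fin n => X)

/-- The tensor power of a morphism. -/
abbrev tpowMap {X Y : M} (f : X ⟶ Y) (n : ℕ) : tpow X n ⟶ tpow Y n := tensMap (fun _ => f)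

/-- An algebra over a single-colored operad. -/
structure Alg (P : Operad M) where
  /-- the underlying object -/
  carrier : M
  /-- the action `𝒫(n) ⊗ A^{⊗ n} ⟶ A` -/
  action : ∀ n : ℕ, P.op n ⊗ tpow carrier n ⟶ carrier
  /-- associativity -/
  action_comp : ∀ {n : ℕ} (k : Fin n → ℕ),
    (P.op n ◁ tensMap (fun i => action (k i))) ≫ action n =
      (regroup (P.op n) (fun i => P.op (k i)) k (fun _ => carrier)).hom ≫
        (P.comp k ▷ tpow carrier (∑ i, k i)) ≫ action (∑ i, k i)
  /-- unitality -/
  action_one : (P.one ⊗ₘ (λ_ carrier).inv) ≫ action 1 = (λ_ carrier).hom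
  /-- equivariance -/
  action_perm : ∀ {n : ℕ} (σ : Equiv.Perm (Fin n)),
    (P.act σ ⊗ₘ (tensPerm σ (fun _ => carrier)).hom) ≫ action n = action n

/-- A morphism of algebras over a single-colored operad. -/
@[ext]
structure AlgHom {P : Operad M} (A B : Alg P) where
  /-- the underlying morphism -/
  hom : A.carrier ⟶ B.carrier
  comm : ∀ n : ℕ, A.action n ≫ hom = (P.op n ◁ tpowMap hom n) ≫ B.action n

/-- The category `Alg_𝒫` of algebras over a single-colored operad. -/
instance (P : Operad M) : Category.{v} (Alg P) where
  Hom A B := AlgHom A B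
  id A := ⟨𝟙 A.carrier, fun n => by simp [tensMap_id]⟩
  comp f g := ⟨f.hom ≫ g.hom, fun n => by
    rw [← Category.assoc, f.comm, Category.assoc, g.comm, ← whiskerLeft_comp_assoc]
    exact congrArg (fun t => P.op n ◁ t ≫ _) (tensMap_comp _ _).symm⟩
  id_comp f := AlgHom.ext (Category.id_comp f.hom)
  comp_id f := AlgHom.ext (Category.comp_id f.hom)
  assoc f g h := AlgHom.ext (Category.assoc f.hom g.hom h.hom)

/-- An (arity `2`) bipointed single-colored operad: an operad with two chosen operations of
arity `2`. (A morphism to `U(𝒫)` from the sequence that is the unit object in arity `2`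
and initial in all other arities is the same as a morphism `𝟙 ⟶ 𝒫(2)`.) -/
structure BipointedOperad (M : Type u) [Category.{v} M] [MonoidalCategory M]
    [SymmetricCategory M] extends Operad M where
  /-- the first point -/
  r₁ : 𝟙_ M ⟶ op 2
  /-- the second point -/
  r₂ : 𝟙_ M ⟶ op 2

end Algebra

/-! ### Orthogonal categories -/

/-- An orthogonality relation on a category: a set of pairs of morphisms with common target
that is symmetric and stable under compositions. -/
structure Orthogonality (C : Type v) [SmallCategory C] where
  /-- the relation `f₁ ⊥ f₂` -/
  perp : ∀ ⦃c₁ c₂ c : C⦄, (c₁ ⟶ c) → (c₂ ⟶ c) → Prop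
  symm : ∀ ⦃c₁ c₂ c : C⦄ (f₁ : c₁ ⟶ c) (f₂ : c₂ ⟶ c), perp f₁ f₂ → perp f₂ f₁
  comp : ∀ ⦃b₁ b₂ c₁ c₂ c d : C⦄ (g : c ⟶ d) (f₁ : c₁ ⟶ c) (f₂ : c₂ ⟶ c)
    (h₁ : b₁ ⟶ c₁) (h₂ : b₂ ⟶ c₂), perp f₁ f₂ → perp (h₁ ≫ f₁ ≫ g) (h₂ ≫ f₂ ≫ g)

/-- A functor is orthogonal if it preserves orthogonality. -/
def IsOrthogonal {C D : Type v} [SmallCategory C] [SmallCategory D]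
    (oC : Orthogonality C) (oD : Orthogonality D) (F : C ⥤ D) : Prop :=
  ∀ ⦃c₁ c₂ c : C⦄ (f₁ : c₁ ⟶ c) (f₂ : c₂ ⟶ c), oC.perp f₁ f₂ → oD.perp (F.map f₁) (F.map f₂)

/-- The pushforward `F_*(⊥)`: the smallest orthogonality relation on `D` for which the functor
`F : C ⥤ D` is orthogonal. -/
def Orthogonality.pushforward {C D : Type v} [SmallCategory C] [SmallCategory D]
    (oC : Orthogonality C) (F : C ⥤ D) : Orthogonality D where
  perp _ _ _ g₁ g₂ := ∀ oD : Orthogonality D, IsOrthogonal oC oD F → oD.perp g₁ g₂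
  symm _ _ _ _ _ h oD hF := oD.symm _ _ (h oD hF)
  comp _ _ _ _ _ _ g _ _ h₁ h₂ h oD hF := oD.comp g _ _ h₁ h₂ (h oD hF)

theorem isOrthogonal_pushforward {C D : Type v} [SmallCategory C] [SmallCategory D]
    (oC : Orthogonality C) (F : C ⥤ D) : IsOrthogonal oC (oC.pushforward F) F :=
  fun _ _ _ f₁ f₂ h _ hF => hF f₁ f₂ h

/-! ### Field theories -/

section FT

variable {M : Type u} [Category.{v} M] [MonoidalCategory M] [SymmetricCategory M]

/-- For a functor `𝔄 : C ⥤ Alg_𝒫`, an operation `r` of arity `2` and `f₁ : c₁ ⟶ c`,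
`f₂ : c₂ ⟶ c`, the composite
`𝟙 ⊗ 𝔄(c₁) ⊗ 𝔄(c₂) ⟶ 𝒫(2) ⊗ 𝔄(c)^{⊗ 2} ⟶ 𝔄(c)`
of `r ⊗ 𝔄(f₁) ⊗ 𝔄(f₂)` and the action. -/
def binaryOp {P : Operad M} {C : Type v} [SmallCategory C] (A : C ⥤ Alg P)
    (r : 𝟙_ M ⟶ P.op 2) {c₁ c₂ c : C} (f₁ : c₁ ⟶ c) (f₂ : c₂ ⟶ c) :
    𝟙_ M ⊗ ((A.obj c₁).carrier ⊗ (A.obj c₂).carrier) ⟶ (A.obj c).carrier :=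
  (r ⊗ₘ ((A.map f₁).hom ⊗ₘ (A.map f₂).hom)) ≫
    (P.op 2 ◁ ((λ_ (A.obj c).carrier).inv ▷ (A.obj c).carrier)) ≫ (A.obj c).action 2

/-- The property of a functor `𝔄 : C ⥤ Alg_𝒫` to be a field theory of type `𝒫^{(r₁,r₂)}` on
the orthogonal category `(C, ⊥)`. -/
def IsFieldTheory {C : Type v} [SmallCategory C] (oC : Orthogonality C) (P : BipointedOperad M) :
    ObjectProperty (C ⥤ Alg P.toOperad) :=
  fun A => ∀ ⦃c₁ c₂ c : C⦄ (f₁ : c₁ ⟶ c) (f₂ : c₂ ⟶ c), oC.perp f₁ f₂ →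
    binaryOp A P.r₁ f₁ f₂ = binaryOp A P.r₂ f₁ f₂

/-- The category of field theories of type `𝒫^{(r₁,r₂)}` on `(C, ⊥)`. -/
abbrev FT {C : Type v} [SmallCategory C] (oC : Orthogonality C) (P : BipointedOperad M) :=
  (IsFieldTheory oC P).FullSubcategory

/-- The pullback functor `F^*` between categories of field theories, along an orthogonal
functor `F`. -/
def pullback {C D : Type v} [SmallCategory C] [SmallCategory D] {oC : Orthogonality C}
    {oD : Orthogonality D} (P : BipointedOperad M) (F : C ⥤ D) (hF : IsOrthogonal oC oD F) :
    FT oD P ⥤ FT oC P :=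
  (IsFieldTheory oC P).lift
    ((IsFieldTheory oD P).ι ⋙ (Functor.whiskeringLeft C D (Alg P.toOperad)).obj F)
    (fun B _ _ _ f₁ f₂ h => B.property (F.map f₁) (F.map f₂) (hF f₁ f₂ h))

/-- A field theory is `W`-constant if it maps the morphisms in `W` to isomorphisms. -/
def IsWConstant {C : Type v} [SmallCategory C] (oC : Orthogonality C) (P : BipointedOperad M)
    (W : MorphismProperty C) : ObjectProperty (FT oC P) :=
  fun A => ∀ ⦃c c' : C⦄ (f : c ⟶ c'), W f → IsIso (A.obj.map f)

/-- The category of `W`-constant field theories. -/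
abbrev WConstFT {C : Type v} [SmallCategory C] (oC : Orthogonality C) (P : BipointedOperad M)
    (W : MorphismProperty C) :=
  (IsWConstant oC P W).FullSubcategory

variable {C D : Type v} [SmallCategory C] [SmallCategory D]

/-- The functor `L^*` from field theories on the orthogonal localization `(C[W⁻¹], L_*(⊥))` to
field theories on `(C, ⊥)`. -/
abbrev locPullback (oC : Orthogonality C) (P : BipointedOperad M) (L : C ⥤ D) :
    FT (oC.pushforward L) P ⥤ FT oC P :=
  pullback P L (isOrthogonal_pushforward oC L)

theorem isWConstant_locPullback (oC : Orthogonality C) (P : BipointedOperad M)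
    (W : MorphismProperty C) (L : C ⥤ D) [L.IsLocalization W] (B : FT (oC.pushforward L) P) :
    IsWConstant oC P W ((locPullback oC P L).obj B) := by
  intro c c' f hf
  have : IsIso (L.map f) := Localization.inverts L W f hf
  change IsIso (B.obj.map (L.map f))
  infer_instance

/-- The functor `L^*` with values in `W`-constant field theories. -/
def locPullbackW (oC : Orthogonality C) (P : BipointedOperad M)
    (W : MorphismProperty C) (L : C ⥤ D) [L.IsLocalization W] :
    FT (oC.pushforward L) P ⥤ WConstFT oC P W :=
  (IsWConstant oC P W).lift (locPullback oC P L) (isWConstant_locPullback oC P W L)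

/-- The restriction of an adjunction `L_! ⊣ L^*` to `W`-constant field theories: its left adjoint
is the restriction of `L_!` to `W`-constant field theories, its right adjoint is `L^*`. -/
noncomputable def restrictedAdjunction (oC : Orthogonality C) (P : BipointedOperad M)
    (W : MorphismProperty C) (L : C ⥤ D) [L.IsLocalization W]
    {Lsh : FT oC P ⥤ FT (oC.pushforward L) P} (adj : Lsh ⊣ locPullback oC P L) :
    (IsWConstant oC P W).ι ⋙ Lsh ⊣ locPullbackW oC P W L :=
  adj.restrictFullyFaithful (iC := (IsWConstant oC P W).ι) (iD := 𝟭 _)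
    (IsWConstant oC P W).fullyFaithfulι (Functor.FullyFaithful.id _) (Iso.refl _) (Iso.refl _)

end FT

end FieldTheory

/-! Two facts carry the theorem: `L^*` is fully faithful with essential image the `W`-constant field
theories, and `L^*` has a left adjoint. The remaining claims are formal: a fully faithful right
adjoint has invertible counit, and the unit at `A` is invertible exactly when `A` lies in the
essential image.

Full faithfulness is inherited from precomposition with a localization, since field theories form
full subcategories of functor categories. For the image, a `W`-constant `A` factors through `L` up
to isomorphism as `L ⋙ B`, and one has to see that `B` is a field theory for the pushforward
relation. The pairs on which `B` satisfies the field theory condition in both orders form an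
orthogonality relation (`inducedOrthogonality`). It makes `L` orthogonal because `L ⋙ B` is a field
theory, so it contains the smallest such relation (`isFieldTheory_pushforward`).

The left adjoint exists for every orthogonal functor `F` and is built by generators and relations
(`pullback_isRightAdjoint`). Diagrams with operations but no equations are algebras of the
endofunctor `X ↦ ∐ₙ 𝒫(n) ⊗ X^{⊗ n}`, applied objectwise. As `⊗` preserves colimits in each variable,
this endofunctor preserves sifted colimits. Sequential colimits then give free algebras
(`exists_free_algebra`), and reflexive coequalizers give quotients by arbitrary pairs of maps
(`exists_quotient_algebra`). The quotient map is an epimorphism, and tensor products of epimorphisms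
are again epimorphisms, so equations imposed on the generators hold throughout the quotient. This
last step needs both sides of each equation to be natural, hence the naturality of all the
rearrangement isomorphisms. -/

namespace FieldTheory

/-! ### Free algebras and quotient algebras of an endofunctor -/

section FreeAlgebra

variable {K : Type u} [Category.{v} K] (H : K ⥤ K) (X : K)

section Chain

variable [HasInitial K] [HasBinaryCoproducts K]

/-- The stages `∅, X ⨿ H ∅, X ⨿ H (X ⨿ H ∅), …` of the construction of the free `H`-algebra
on `X`. -/
noncomputable def freeStage : ℕ → K
  | 0 => ⊥_ K
  | n + 1 => X ⨿ H.obj (freeStage n)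

/-- The map from `X` to the later stages of the free algebra. -/
noncomputable def freeStageInl (n : ℕ) : X ⟶ freeStage H X (n + 1) :=
  (coprod.inl : X ⟶ X ⨿ H.obj (freeStage H X n))

/-- The structure map from one stage of the free algebra to the next. -/
noncomputable def freeStageInr (n : ℕ) : H.obj (freeStage H X n) ⟶ freeStage H X (n + 1) :=
  (coprod.inr : H.obj (freeStage H X n) ⟶ X ⨿ H.obj (freeStage H X n))

/-- The map out of a stage of the free algebra given by its values on the two summands. -/
noncomputable def freeStageDesc {n : ℕ} {Y : K} (f : X ⟶ Y) (g : H.obj (freeStage H X n) ⟶ Y) :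
    freeStage H X (n + 1) ⟶ Y :=
  (coprod.desc f g : X ⨿ H.obj (freeStage H X n) ⟶ Y)

theorem freeStageInl_desc {n : ℕ} {Y : K} (f : X ⟶ Y) (g : H.obj (freeStage H X n) ⟶ Y) :
    freeStageInl H X n ≫ freeStageDesc H X f g = f :=
  coprod.inl_desc f g

theorem freeStageInr_desc {n : ℕ} {Y : K} (f : X ⟶ Y) (g : H.obj (freeStage H X n) ⟶ Y) :
    freeStageInr H X n ≫ freeStageDesc H X f g = g :=
  coprod.inr_desc f g

theorem freeStage_hom_ext {n : ℕ} {Y : K} {f g : freeStage H X (n + 1) ⟶ Y}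
    (h₁ : freeStageInl H X n ≫ f = freeStageInl H X n ≫ g)
    (h₂ : freeStageInr H X n ≫ f = freeStageInr H X n ≫ g) : f = g :=
  coprod.hom_ext (X := X) (Y := H.obj (freeStage H X n)) h₁ h₂

theorem freeStage_zero_hom_ext {Y : K} (f g : freeStage H X 0 ⟶ Y) : f = g :=
  initial.hom_ext f g

/-- The transition maps between the stages of the free `H`-algebra. -/
noncomputable def freeStageMap : ∀ n, freeStage H X n ⟶ freeStage H X (n + 1)
  | 0 => initial.to _
  | n + 1 => freeStageDesc H X (freeStageInl H X (n + 1))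
      (H.map (freeStageMap n) ≫ freeStageInr H X (n + 1))

theorem freeStageInl_map (n : ℕ) :
    freeStageInl H X n ≫ freeStageMap H X (n + 1) = freeStageInl H X (n + 1) :=
  freeStageInl_desc _ _ _ _

theorem freeStageInr_map (n : ℕ) : freeStageInr H X n ≫ freeStageMap H X (n + 1) =
    H.map (freeStageMap H X n) ≫ freeStageInr H X (n + 1) :=
  freeStageInr_desc _ _ _ _

/-- The maps from the stages of the free algebra to an algebra, induced by a map from `X`. -/
noncomputable def freeStageLift {B : Endofunctor.Algebra H} (f : X ⟶ B.a) :
    ∀ n, freeStage H X n ⟶ B.a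
  | 0 => initial.to _
  | n + 1 => freeStageDesc H X f (H.map (freeStageLift f n) ≫ B.str)

theorem freeStageInl_lift {B : Endofunctor.Algebra H} (f : X ⟶ B.a) (n : ℕ) :
    freeStageInl H X n ≫ freeStageLift H X f (n + 1) = f :=
  freeStageInl_desc _ _ _ _

theorem freeStageInr_lift {B : Endofunctor.Algebra H} (f : X ⟶ B.a) (n : ℕ) :
    freeStageInr H X n ≫ freeStageLift H X f (n + 1) = H.map (freeStageLift H X f n) ≫ B.str :=
  freeStageInr_desc _ _ _ _

theorem freeStageMap_lift {B : Endofunctor.Algebra H} (f : X ⟶ B.a) :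
    ∀ n, freeStageMap H X n ≫ freeStageLift H X f (n + 1) = freeStageLift H X f n
  | 0 => freeStage_zero_hom_ext H X _ _
  | n + 1 => freeStage_hom_ext H X
      (by rw [reassoc_of% @freeStageInl_map, freeStageInl_lift, freeStageInl_lift])
      (by rw [reassoc_of% @freeStageInr_map, freeStageInr_lift, freeStageInr_lift,
            ← Functor.map_comp_assoc, freeStageMap_lift f n])

/-- A cocone over a sequence. -/
noncomputable def coconeOfSequence {Y : ℕ → K} (y : ∀ n, Y n ⟶ Y (n + 1)) {Z : K}
    (f : ∀ n, Y n ⟶ Z) (hf : ∀ n, y n ≫ f (n + 1) = f n) :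
    Cocone (Functor.ofSequence y) where
  pt := Z
  ι := NatTrans.ofSequence f (fun n => by
    rw [Functor.ofSequence_map_homOfLE_succ]
    exact (hf n).trans (Category.comp_id _).symm)

end Chain

/-- The colimit `Z` of the stages is the free algebra: `H` preserves this colimit, so the maps from
`H` of a stage to the next stage glue to `H Z ⟶ Z`. -/
theorem exists_free_algebra [HasInitial K] [HasBinaryCoproducts K] [HasColimitsOfShape ℕ K]
    [PreservesColimitsOfShape ℕ H] :
    ∃ (A : Endofunctor.Algebra H) (η : X ⟶ A.a), ∀ (B : Endofunctor.Algebra H) (f : X ⟶ B.a),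
      ∃! g : A ⟶ B, η ≫ g.f = f := by
  let S : ℕ ⥤ K := Functor.ofSequence (freeStageMap H X)
  have hS : ∀ n, S.map (homOfLE (Nat.le_succ n)) = freeStageMap H X n :=
    Functor.ofSequence_map_homOfLE_succ _
  let Z := colimit S
  let i : ∀ n, freeStage H X n ⟶ Z := fun n => colimit.ι S n
  have hi : ∀ n, freeStageMap H X n ≫ i (n + 1) = i n := fun n =>
    (congrArg (· ≫ i (n + 1)) (hS n).symm).trans (colimit.w S _)
  have hH : IsColimit (H.mapCocone (colimit.cocone S)) :=
    isColimitOfPreserves H (colimit.isColimit _)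
  -- A cocone needs compatibility with all `m ≤ n`, while the transition maps are known explicitly
  -- only for successors; hence the induction.
  have hs : ∀ m n : ℕ, ∀ h : m ≤ n, (S ⋙ H).map (homOfLE h) ≫
      (freeStageInr H X n ≫ i (n + 1)) = freeStageInr H X m ≫ i (m + 1) := by
    intro m n h
    induction n, h using Nat.le_induction with
    | base =>
      exact (congrArg (· ≫ _) ((S ⋙ H).map_id m)).trans (Category.id_comp _)
    | succ n h ih =>
      have e : homOfLE (Nat.le_succ_of_le h) = homOfLE h ≫ homOfLE (Nat.le_succ n) := rfl
      rw [e, Functor.map_comp, Category.assoc, ← ih]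
      congr 1
      refine (congrArg (fun t => H.map t ≫ _) (hS n)).trans ?_
      have e' : freeStageInr H X n ≫ i (n + 1) =
          H.map (freeStageMap H X n) ≫ freeStageInr H X (n + 1) ≫ i (n + 2) := by
        rw [← hi (n + 1), reassoc_of% @freeStageInr_map]
      exact e'.symm
  let c : Cocone (S ⋙ H) :=
    { pt := Z
      ι := { app := fun n => freeStageInr H X n ≫ i (n + 1)
             naturality := fun m n h => by
              rw [show h = homOfLE (leOfHom h) from rfl, hs]
              exact (Category.comp_id _).symm } }
  obtain ⟨str, hstr⟩ : ∃ str : H.obj Z ⟶ Z,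
      ∀ n, H.map (i n) ≫ str = freeStageInr H X n ≫ i (n + 1) :=
    ⟨hH.desc c, fun n => hH.fac c n⟩
  have hη : ∀ n, freeStageInl H X n ≫ i (n + 1) = freeStageInl H X 0 ≫ i 1 := by
    intro n
    induction n with
    | zero => rfl
    | succ n ih => rw [← ih, ← hi (n + 1), reassoc_of% @freeStageInl_map]
  refine ⟨⟨Z, str⟩, freeStageInl H X 0 ≫ i 1, fun B f => ?_⟩
  obtain ⟨g, hg⟩ : ∃ g : Z ⟶ B.a, ∀ n, i n ≫ g = freeStageLift H X f n :=
    ⟨colimit.desc S (coconeOfSequence (freeStageMap H X) _ (freeStageMap_lift H X f)),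
      fun n => colimit.ι_desc _ n⟩
  refine ⟨⟨g, ?_⟩, ?_, ?_⟩
  · refine hH.hom_ext fun n => ?_
    change H.map (i n) ≫ H.map g ≫ B.str = H.map (i n) ≫ str ≫ g
    rw [← Functor.map_comp_assoc, hg, ← Category.assoc, hstr, Category.assoc, hg,
      freeStageInr_lift]
  · change (freeStageInl H X 0 ≫ i 1) ≫ g = f
    rw [Category.assoc, hg, freeStageInl_lift]
  · rintro ⟨k, hk⟩ hf
    change H.map k ≫ B.str = str ≫ k at hk
    change (freeStageInl H X 0 ≫ i 1) ≫ k = f at hf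
    -- Uniqueness is checked stage by stage: on a successor stage, the value on `X` is prescribed,
    -- and the value on the other summand is forced by the previous stage.
    refine Endofunctor.Algebra.ext (?_ : k = g)
    refine colimit.hom_ext fun n => ?_
    change i n ≫ k = i n ≫ g
    rw [hg]
    induction n with
    | zero => exact freeStage_zero_hom_ext H X _ _
    | succ n ih =>
      refine freeStage_hom_ext H X ?_ ?_
      · rw [freeStageInl_lift, ← Category.assoc, hη, hf]
      · rw [freeStageInr_lift, ← Category.assoc, ← hstr, Category.assoc, ← hk,
          ← Functor.map_comp_assoc, ih]

end FreeAlgebra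

/-! ### Quotients of algebras by reflexive coequalizers. -/

section Quotient

variable {K : Type u} [Category.{v} K] {H : K ⥤ K}

/-- The algebra quotient of `B` which makes two maps `s, t : G ⟶ B` equal. -/
theorem exists_quotient_algebra [HasInitial K] [HasBinaryCoproducts K] [HasColimitsOfShape ℕ K]
    [HasColimitsOfShape WalkingReflexivePair K]
    [PreservesColimitsOfShape ℕ H] [PreservesColimitsOfShape WalkingReflexivePair H]
    (B : Endofunctor.Algebra H) {G : K} (s t : G ⟶ B.a) :
    ∃ (Q : Endofunctor.Algebra H) (q : B ⟶ Q), Epi q.f ∧ Epi (H.map q.f) ∧ s ≫ q.f = t ≫ q.f ∧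
      ∀ (T : Endofunctor.Algebra H) (g : B ⟶ T), s ≫ g.f = t ≫ g.f → ∃ g' : Q ⟶ T, q ≫ g' = g := by
  -- The free algebra on `G` would suffice to encode the relations; the extra summand `B.a`, mapped
  -- identically by both homomorphisms, provides a common section in `K` and makes the pair
  -- reflexive.
  obtain ⟨F, η, hF⟩ := exists_free_algebra H (G ⨿ B.a)
  obtain ⟨s', hs', -⟩ := hF B (coprod.desc s (𝟙 _))
  obtain ⟨t', ht', -⟩ := hF B (coprod.desc t (𝟙 _))
  have hsr : (coprod.inr ≫ η) ≫ s'.f = 𝟙 _ := by rw [Category.assoc, hs', coprod.inr_desc]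
  have htr : (coprod.inr ≫ η) ≫ t'.f = 𝟙 _ := by rw [Category.assoc, ht', coprod.inr_desc]
  let D := reflexivePair s'.f t'.f (coprod.inr ≫ η) hsr htr
  let c := colimit.cocone D
  have hc : IsColimit c := colimit.isColimit D
  have hHc : IsColimit (H.mapCocone c) := isColimitOfPreserves H hc
  let π : B.a ⟶ c.pt := c.ι.app .zero
  have hone : ∀ (E : WalkingReflexivePair ⥤ K) (d : Cocone E) ,
      d.ι.app .one = E.map .left ≫ d.ι.app .zero := fun E d => (d.w .left).symm
  have ext : ∀ (E : WalkingReflexivePair ⥤ K) (d : Cocone E), IsColimit d →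
      ∀ {Y : K} (a b : d.pt ⟶ Y), d.ι.app .zero ≫ a = d.ι.app .zero ≫ b → a = b := by
    intro E d hd Y a b h
    refine hd.hom_ext ?_
    rintro (_ | _)
    · exact h
    · change d.ι.app .one ≫ _ = d.ι.app .one ≫ _
      rw [hone, Category.assoc, h, Category.assoc]
  have hπ : s'.f ≫ π = t'.f ≫ π := (c.w .left).trans (c.w .right).symm
  have hst : H.map s'.f ≫ B.str ≫ π = H.map t'.f ≫ B.str ≫ π := by
    rw [← Category.assoc, s'.h, Category.assoc, hπ, ← Category.assoc, ← t'.h, Category.assoc]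
  let e : ReflexiveCofork (D ⋙ H) := ReflexiveCofork.mk (F := D ⋙ H) (B.str ≫ π) hst
  -- `H` preserves the coequalizer, so the structure map of `B` descends to it.
  obtain ⟨str, hQ⟩ : ∃ str : H.obj c.pt ⟶ c.pt, H.map π ≫ str = B.str ≫ π :=
    ⟨hHc.desc e, hHc.fac e .zero⟩
  let Q : Endofunctor.Algebra H := ⟨c.pt, str⟩
  let q : B ⟶ Q := ⟨π, hQ⟩
  refine ⟨Q, q, ⟨fun a b h => ext _ _ hc a b h⟩, ⟨fun a b h => ext _ _ hHc a b h⟩, ?_, ?_⟩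
  · have h := congrArg (fun k => (coprod.inl ≫ η) ≫ k) hπ
    simp only [Category.assoc] at h
    rwa [← Category.assoc η, hs', ← Category.assoc η, ht', coprod.inl_desc_assoc,
      coprod.inl_desc_assoc] at h
  · intro T g hg
    have hg' : s' ≫ g = t' ≫ g := by
      -- Both composites extend the same map on the generators `G ⨿ B.a`, so they agree by freeness.
      obtain ⟨_, -, hu⟩ := hF T (coprod.desc (s ≫ g.f) g.f)
      rw [hu (s' ≫ g) ?_, hu (t' ≫ g) ?_]
      · change η ≫ (t' ≫ g).f = _
        rw [Endofunctor.Algebra.comp_f, ← Category.assoc, ht', coprod.desc_comp, hg,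
          Category.id_comp]
      · change η ≫ (s' ≫ g).f = _
        rw [Endofunctor.Algebra.comp_f, ← Category.assoc, hs', coprod.desc_comp, Category.id_comp]
    let r : ReflexiveCofork D := ReflexiveCofork.mk (F := D) g.f
      (congrArg Endofunctor.Algebra.Hom.f hg')
    obtain ⟨k, hr⟩ : ∃ k : c.pt ⟶ T.a, π ≫ k = g.f := ⟨hc.desc r, hc.fac r .zero⟩
    refine ⟨⟨k, ext _ _ hHc _ _ ?_⟩, Endofunctor.Algebra.ext hr⟩
    change H.map π ≫ H.map k ≫ T.str = H.map π ≫ str ≫ k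
    rw [← Functor.map_comp_assoc, hr, ← Category.assoc (H.map π), hQ, Category.assoc, hr, g.h]

end Quotient

/-! ### Sifted colimits of tensor powers -/

section Sifted

open WalkingReflexivePair

/-- This is where reflexivity enters: the reflexion supplies the factorizations with equal
composites, which a bare parallel pair would not have. -/
theorem exists_comp_left_right {x : WalkingReflexivePair} (f f' : x ⟶ zero) :
    ∃ r : x ⟶ one, (r ≫ Hom.left = f ∧ r ≫ Hom.right = f') ∨
      (r ≫ Hom.left = f' ∧ r ≫ Hom.right = f) := by
  cases x
  · rcases f with ⟨⟩; rcases f' with ⟨⟩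
    exact ⟨Hom.reflexion, Or.inl ⟨rfl, rfl⟩⟩
  · rcases f with ⟨⟩ | ⟨⟩ <;> rcases f' with ⟨⟩ | ⟨⟩
    · exact ⟨Hom.leftCompReflexion, Or.inl ⟨rfl, rfl⟩⟩
    · exact ⟨𝟙 _, Or.inl ⟨rfl, rfl⟩⟩
    · exact ⟨𝟙 _, Or.inr ⟨rfl, rfl⟩⟩
    · exact ⟨Hom.rightCompReflexion, Or.inl ⟨rfl, rfl⟩⟩

theorem exists_comp_eq {x : WalkingReflexivePair} (f : x ⟶ zero) :
    ∃ r : x ⟶ one, r ≫ Hom.left = f ∧ r ≫ Hom.right = f := by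
  obtain ⟨r, h | h⟩ := exists_comp_left_right f f <;> exact ⟨r, h⟩

/-- Every cospan under a pair of objects can be pushed to one over `zero`. There the legs are
changed one at a time: a cospan over `one` realizes two values of one leg via `left` and `right`
while keeping the other leg fixed. -/
instance isSifted_walkingReflexivePair : IsSifted WalkingReflexivePair := by
  have hcon : ∀ d : WalkingReflexivePair × WalkingReflexivePair,
      IsConnected (StructuredArrow d (Functor.diag WalkingReflexivePair)) := by
    intro d
    let ob : ∀ (z : WalkingReflexivePair) (f : d.1 ⟶ z) (g : d.2 ⟶ z),
        StructuredArrow d (Functor.diag WalkingReflexivePair) := fun z f g =>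
      StructuredArrow.mk (Y := z) (show d ⟶ (Functor.diag _).obj z from Prod.mkHom f g)
    have hob : ∀ {z z' : WalkingReflexivePair} (f : d.1 ⟶ z) (g : d.2 ⟶ z) (k : z ⟶ z')
        {f' : d.1 ⟶ z'} {g' : d.2 ⟶ z'}, f ≫ k = f' → g ≫ k = g' →
        Zigzag (ob z f g) (ob z' f' g') := by
      rintro z z' f g k _ _ rfl rfl
      exact Zigzag.of_hom (StructuredArrow.homMk k rfl)
    have hred : ∀ x : StructuredArrow d (Functor.diag WalkingReflexivePair),
        ∃ (f : d.1 ⟶ zero) (g : d.2 ⟶ zero), Zigzag x (ob zero f g) := by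
      rintro ⟨⟨⟨⟩⟩, z, f, g⟩
      cases z
      · exact ⟨f, g, Zigzag.refl _⟩
      · exact ⟨f ≫ Hom.left, g ≫ Hom.left, hob f g Hom.left rfl rfl⟩
    have h1 : ∀ (f f' : d.1 ⟶ zero) (g : d.2 ⟶ zero), Zigzag (ob zero f g) (ob zero f' g) := by
      intro f f' g
      obtain ⟨s, hs, hs'⟩ := exists_comp_eq g
      obtain ⟨r, ⟨h, h'⟩ | ⟨h, h'⟩⟩ := exists_comp_left_right f f'
      · exact (hob r s Hom.left h hs).symm.trans (hob r s Hom.right h' hs')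
      · exact (hob r s Hom.right h' hs').symm.trans (hob r s Hom.left h hs)
    have h2 : ∀ (f : d.1 ⟶ zero) (g g' : d.2 ⟶ zero), Zigzag (ob zero f g) (ob zero f g') := by
      intro f g g'
      obtain ⟨s, hs, hs'⟩ := exists_comp_eq f
      obtain ⟨r, ⟨h, h'⟩ | ⟨h, h'⟩⟩ := exists_comp_left_right g g'
      · exact (hob s r Hom.left hs h).symm.trans (hob s r Hom.right hs' h')
      · exact (hob s r Hom.right hs' h').symm.trans (hob s r Hom.left hs h)
    have hne : ∀ z : WalkingReflexivePair, Nonempty (z ⟶ zero) := by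
      rintro (_ | _)
      · exact ⟨𝟙 _⟩
      · exact ⟨Hom.left⟩
    have : Nonempty (StructuredArrow d (Functor.diag WalkingReflexivePair)) :=
      ⟨ob zero (hne d.1).some (hne d.2).some⟩
    refine zigzag_isConnected fun x y => ?_
    obtain ⟨f, g, hx⟩ := hred x
    obtain ⟨f', g', hy⟩ := hred y
    exact (hx.trans ((h1 f f' g).trans (h2 f' g g'))).trans hy.symm
  have : IsSiftedOrEmpty WalkingReflexivePair := ⟨hcon⟩
  exact { nonempty := ⟨zero⟩ }

end Sifted

/-! ### Tensor powers and the functor of formal operations. -/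

section TensorPower

variable {M : Type u} [Category.{v} M] [MonoidalCategory M]

/-- The functor `X ↦ X^{⊗ n}`. -/
def tpowFunctor (n : ℕ) : M ⥤ M where
  obj X := tpow X n
  map f := tpowMap f n
  map_id _ := tensMap_id _
  map_comp _ _ := tensMap_comp _ _

theorem preservesColimitsOfShape_const {J C D : Type*} [Category* J] [Category* C] [Category* D]
    [IsConnected J] (Z : D) : PreservesColimitsOfShape J ((Functor.const C).obj Z) where
  preservesColimit {F} := ⟨fun {c} _ =>
    ⟨IsColimit.ofIsoColimit ((IsColimit.precomposeHomEquiv (Iso.refl _ :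
      F ⋙ (Functor.const C).obj Z ≅ (Functor.const J).obj Z) _).symm
        (isColimitConstCocone J Z)) (Cocone.ext (Iso.refl _) fun _ => by
        simp only [Functor.mapCocone_ι_app, Functor.const_obj_map]
        exact (Category.comp_id _).trans (Category.comp_id _))⟩⟩

/-- Over a sifted shape, the objectwise tensor product of two colimit cocones is again a colimit
cocone, which gives the inductive step. The zeroth power is constant, and a constant functor
preserves connected colimits. -/
theorem tpowFunctor_preservesColimitsOfShape (J : Type*) [Category* J] [IsSifted J]
    [∀ X : M, PreservesColimitsOfShape J (tensorLeft X)]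
    [∀ X : M, PreservesColimitsOfShape J (tensorRight X)] :
    ∀ n, PreservesColimitsOfShape J (tpowFunctor (M := M) n)
  | 0 => 
      have := preservesColimitsOfShape_const (J := J) (C := M) (𝟙_ M)
      preservesColimitsOfShape_of_natIso (F := (Functor.const M).obj (𝟙_ M))
        (NatIso.ofComponents (fun _ => Iso.refl _) (fun _ => rfl))
  | n + 1 => by
      have ih := tpowFunctor_preservesColimitsOfShape J n
      refine ⟨fun {F} => ⟨fun {c} hc => ⟨?_⟩⟩⟩
      have h1 : ∀ X : M, PreservesColimit (F ⋙ tpowFunctor n) ((curriedTensor M).flip.obj X) :=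
        fun X => inferInstanceAs (PreservesColimit _ (tensorRight X))
      have h2 : ∀ X : M, PreservesColimit F ((curriedTensor M).obj X) :=
        fun X => inferInstanceAs (PreservesColimit _ (tensorLeft X))
      have h := IsColimit.tensor (isColimitOfPreserves (tpowFunctor n) hc) hc
      let e : (F ⋙ tpowFunctor n) ⊗ F ≅ F ⋙ tpowFunctor (n + 1) :=
        NatIso.ofComponents (fun _ => Iso.refl _)
          (fun _ => (Category.comp_id _).trans (Category.id_comp _).symm)
      exact (IsColimit.equivOfNatIsoOfIso e _ ((tpowFunctor (n + 1)).mapCocone c)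
        (Cocone.ext (Iso.refl _) (fun _ => (Category.comp_id _).trans (Category.id_comp _)))) h

/-- The functor `X ↦ ∐ₙ 𝒫(n) ⊗ X^{⊗ n}`. -/
noncomputable def operationFunctor [HasColimits M] (op : ℕ → M) : M ⥤ M where
  obj X := ∐ fun n => op n ⊗ tpow X n
  map f := Limits.Sigma.map fun n => op n ◁ tpowMap f n
  map_id X := by
    ext n
    simp [tensMap_id]
  map_comp f g := by
    ext n
    simp [tensMap_comp]

section Operation

variable [HasColimits M] (op : ℕ → M)

/-- The inclusion of the operations of arity `n`. -/
noncomputable def operationι (n : ℕ) (X : M) : op n ⊗ tpow X n ⟶ (operationFunctor op).obj X :=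
  Sigma.ι (fun n => op n ⊗ tpow X n) n

/-- A map out of `∐ₙ 𝒫(n) ⊗ X^{⊗ n}` given by its components. -/
noncomputable def operationDesc {X Y : M} (f : ∀ n, op n ⊗ tpow X n ⟶ Y) :
    (operationFunctor op).obj X ⟶ Y :=
  Sigma.desc f

theorem operationι_desc {X Y : M} (f : ∀ n, op n ⊗ tpow X n ⟶ Y) (n : ℕ) :
    operationι op n X ≫ operationDesc op f = f n :=
  Sigma.ι_desc _ _

theorem operationι_map {X Y : M} (f : X ⟶ Y) (n : ℕ) :
    operationι op n X ≫ (operationFunctor op).map f = (op n ◁ tpowMap f n) ≫ operationι op n Y :=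
  Limits.Sigma.ι_map (fun n => op n ◁ tpowMap f n) n

theorem operation_hom_ext {X Y : M} {f g : (operationFunctor op).obj X ⟶ Y}
    (h : ∀ n, operationι op n X ≫ f = operationι op n X ≫ g) : f = g :=
  Sigma.hom_ext _ _ h

instance operationFunctor_preservesColimitsOfShape [SymmetricCategory M] [MonoidalClosed M]
    (J : Type) [SmallCategory J] [IsSifted J] :
    PreservesColimitsOfShape J (operationFunctor op) := by
  have hl : ∀ X : M, PreservesColimitsOfShape J (tensorLeft X) := fun X =>
    (ihom.adjunction X).leftAdjoint_preservesColimits.preservesColimitsOfShape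
  have hr : ∀ X : M, PreservesColimitsOfShape J (tensorRight X) := fun X =>
    preservesColimitsOfShape_of_natIso (BraidedCategory.tensorLeftIsoTensorRight X)
  refine ⟨fun {F} => ⟨fun {c} hc => ⟨?_⟩⟩⟩
  have h : ∀ n, IsColimit ((tpowFunctor n ⋙ tensorLeft (op n)).mapCocone c) := fun n => by
    have := tpowFunctor_preservesColimitsOfShape (M := M) J n
    exact isColimitOfPreserves _ hc
  -- A cocone under the coproduct is a family of cocones, one for each arity, so the universal
  -- property is checked arity by arity.
  let s' : ∀ (s : Cocone (F ⋙ operationFunctor op)) (n : ℕ),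
      Cocone (F ⋙ tpowFunctor n ⋙ tensorLeft (op n)) := fun s n =>
    { pt := s.pt
      ι := { app := fun j => operationι op n (F.obj j) ≫ s.ι.app j
             naturality := fun j k f => by
              have e : operationι op n (F.obj j) ≫ s.ι.app j =
                  (op n ◁ tpowMap (F.map f) n) ≫ operationι op n (F.obj k) ≫ s.ι.app k := by
                rw [← s.w f, Functor.comp_map, reassoc_of% @operationι_map]
              exact e.symm.trans (Category.comp_id _).symm } }
  have D : ∀ (s : Cocone (F ⋙ operationFunctor op)) (n : ℕ),
      ∃ m : op n ⊗ tpow c.pt n ⟶ s.pt, (∀ j, (op n ◁ tpowMap (c.ι.app j) n) ≫ m =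
        operationι op n (F.obj j) ≫ s.ι.app j) ∧
        ∀ m', (∀ j, (op n ◁ tpowMap (c.ι.app j) n) ≫ m' =
          operationι op n (F.obj j) ≫ s.ι.app j) → m' = m :=
    fun s n => ⟨(h n).desc (s' s n), (h n).fac (s' s n), (h n).uniq (s' s n)⟩
  choose d hd hu using D
  refine { desc := fun s => operationDesc op (d s), fac := ?_, uniq := ?_ }
  · intro s j
    refine operation_hom_ext op fun n => ?_
    change operationι op n (F.obj j) ≫ (operationFunctor op).map (c.ι.app j) ≫ _ = _
    rw [reassoc_of% @operationι_map]
    exact (congrArg (_ ≫ ·) (operationι_desc op (d s) n)).trans (hd s n j)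
  · intro s (m : (operationFunctor op).obj c.pt ⟶ s.pt) hm
    refine operation_hom_ext op fun n => ?_
    rw [operationι_desc]
    refine hu s n _ fun j => ?_
    rw [← hm j]
    exact ((reassoc_of% (operationι_map op (c.ι.app j) n)) m).symm

end Operation

end TensorPower

/-! ### Naturality of the rearrangements of tensor products -/

section Naturality

variable {M : Type u} [Category.{v} M] [MonoidalCategory M]

/-- Handles reindexings under which the factors agree only propositionally, which is why the
morphisms are compared by `HEq`. -/
theorem tensMap_eqToHom {n : ℕ} {X X' Y Y' : Fin n → M} (hX : X = X') (hY : Y = Y')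
    (f : ∀ i, X i ⟶ Y i) (f' : ∀ i, X' i ⟶ Y' i) (h : ∀ i, HEq (f i) (f' i))
    (eX : tens X = tens X') (eY : tens Y = tens Y') :
    tensMap f ≫ eqToHom eY = eqToHom eX ≫ tensMap f' := by
  subst hX hY
  obtain rfl : f = f' := funext fun i => eq_of_heq (h i)
  simp

theorem tensCast_naturality {m n : ℕ} (h : m = n) {X Y : Fin n → M} (f : ∀ i, X i ⟶ Y i) :
    tensMap f ≫ (tensCast h Y).hom = (tensCast h X).hom ≫ tensMap (fun i => f (Fin.cast h i)) := by
  subst h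
  exact (Category.comp_id (tensMap f)).trans (Category.id_comp (tensMap f)).symm

theorem tensCongr_naturality {ι : Type} {X Y : ι → M} (f : ∀ i, X i ⟶ Y i) {n : ℕ}
    {p q : Fin n → ι} (h : p = q) :
    tensMap (fun i => f (p i)) ≫ (tensCongr Y h).hom =
      (tensCongr X h).hom ≫ tensMap (fun i => f (q i)) := by
  subst h
  exact (Category.comp_id (tensMap _)).trans (Category.id_comp (tensMap _)).symm

theorem tensAdd_naturality (m : ℕ) : (n : ℕ) → {X Y : Fin (m + n) → M} → (f : ∀ i, X i ⟶ Y i) →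
    tensMap f ≫ (tensAdd m n Y).hom = (tensAdd m n X).hom ≫
      (tensMap (fun i => f (Fin.castAdd n i)) ⊗ₘ tensMap (fun j => f (Fin.natAdd m j)))
  | 0, X, Y, f => by
      change tensMap f ≫ (ρ_ (tens Y)).inv = (ρ_ (tens X)).inv ≫ (tensMap f ⊗ₘ 𝟙 (𝟙_ M))
      rw [tensorHom_id, rightUnitor_inv_naturality]
  | n + 1, X, Y, f => by
      have ih := tensAdd_naturality m n (fun i => f i.castSucc)
      have key : ∀ {A A' B B' C C' D D' : M} (a : A ⟶ A') (b : B ⟶ B') (c : C ⟶ C') (d : D ⟶ D')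
          (e : A ⟶ B ⊗ C) (e' : A' ⟶ B' ⊗ C'), a ≫ e' = e ≫ (b ⊗ₘ c) →
          (a ⊗ₘ d) ≫ e' ▷ D' ≫ (α_ B' C' D').hom =
            (e ▷ D ≫ (α_ B C D).hom) ≫ (b ⊗ₘ (c ⊗ₘ d)) := by
        intro A A' B B' C C' D D' a b c d e e' h
        rw [Category.assoc, ← associator_naturality, ← tensorHom_id, ← tensorHom_id,
          tensorHom_comp_tensorHom_assoc, tensorHom_comp_tensorHom_assoc, h, Category.comp_id,
          Category.id_comp]
      exact key _ _ _ _ _ _ ih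

theorem tensSigma_naturality : {n : ℕ} → (k : Fin n → ℕ) → {X Y : Fin (∑ i, k i) → M} →
    (f : ∀ i, X i ⟶ Y i) → tensMap f ≫ (tensSigma k Y).hom =
      (tensSigma k X).hom ≫ tensMap (fun i => tensMap (fun j => f (blk k i j)))
  | 0, k, X, Y, f => tensCast_naturality (m := 0) (by simp) f
  | n + 1, k, X, Y, f => by
      have heq : ∀ {l : ℕ} {p q : Fin l → Fin (∑ i, k i)}, p = q →
          HEq (tensMap fun j => f (p j)) (tensMap fun j => f (q j)) := by
        rintro l p q rfl; rfl
      have h1 := tensCast_naturality (Fin.sum_univ_castSucc k).symm f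
      have h2 := tensAdd_naturality (∑ i : Fin n, k i.castSucc) (k (Fin.last n))
        (fun i => f (Fin.cast (Fin.sum_univ_castSucc k).symm i))
      have h3 := tensSigma_naturality (fun i => k i.castSucc) (fun i =>
        f (Fin.cast (Fin.sum_univ_castSucc k).symm (Fin.castAdd (k (Fin.last n)) i)))
      have h4 := tensCongr_naturality f (funext fun j => cast_natAdd_blk k j)
      have h5 := tensMap_eqToHom (n := n)
        (X := fun i => tens fun j => X (Fin.cast (Fin.sum_univ_castSucc k).symm
          (Fin.castAdd (k (Fin.last n)) (blk (fun i => k i.castSucc) i j))))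
        (X' := fun i => tens fun j => X (blk k i.castSucc j))
        (Y := fun i => tens fun j => Y (Fin.cast (Fin.sum_univ_castSucc k).symm
          (Fin.castAdd (k (Fin.last n)) (blk (fun i => k i.castSucc) i j))))
        (Y' := fun i => tens fun j => Y (blk k i.castSucc j))
        (by simp only [cast_castAdd_blk]) (by simp only [cast_castAdd_blk])
        (fun i => tensMap fun j => f (Fin.cast (Fin.sum_univ_castSucc k).symm
          (Fin.castAdd (k (Fin.last n)) (blk (fun i => k i.castSucc) i j))))
        (fun i => tensMap fun j => f (blk k i.castSucc j))
        (fun i => heq (funext fun j => cast_castAdd_blk k i j))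
        (by simp only [cast_castAdd_blk]) (by simp only [cast_castAdd_blk])
      -- The pasting of squares is done for arbitrary objects, where the tensor products are
      -- visible; it is then applied up to unfolding `tens`.
      have key : ∀ {A A' B B' C C' D D' E E' F F' G G' : M} {a : A ⟶ A'} {b : B ⟶ B'} {c : C ⟶ C'}
          {d : D ⟶ D'} {e : E ⟶ E'} {g : F ⟶ F'} {h : G ⟶ G'}
          {s : A ⟶ B} {s' : A' ⟶ B'} {t : B ⟶ C ⊗ D} {t' : B' ⟶ C' ⊗ D'} {w : C ⟶ E}
          {w' : C' ⟶ E'} {x : E ⟶ F} {x' : E' ⟶ F'} {y : D ⟶ G} {y' : D' ⟶ G'},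
          a ≫ s' = s ≫ b → b ≫ t' = t ≫ (c ⊗ₘ d) → c ≫ w' = w ≫ e → d ≫ y' = y ≫ h →
          e ≫ x' = x ≫ g → a ≫ s' ≫ t' ≫ ((w' ≫ x') ⊗ₘ y') =
            (s ≫ t ≫ ((w ≫ x) ⊗ₘ y)) ≫ (g ⊗ₘ h) := by
        intro _ _ _ _ _ _ _ _ _ _ _ _ _ _ _ _ _ _ _ _ _ _ _ _ _ _ _ _ _ _ _ h1 h2 h3 h4 h5
        rw [reassoc_of% h1, reassoc_of% h2, Category.assoc, Category.assoc,
          tensorHom_comp_tensorHom, tensorHom_comp_tensorHom, reassoc_of% h3, h4, h5,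
          Category.assoc]
      exact key h1 h2 h3 h4 h5

variable [SymmetricCategory M]

theorem tensTensor_naturality : {n : ℕ} → {X X' Y Y' : Fin n → M} → (f : ∀ i, X i ⟶ X' i) →
    (g : ∀ i, Y i ⟶ Y' i) → (tensMap f ⊗ₘ tensMap g) ≫ (tensTensor X' Y').hom =
      (tensTensor X Y).hom ≫ tensMap (fun i => f i ⊗ₘ g i)
  | 0, _, _, _, _, _, _ => by
      change (𝟙 (𝟙_ M) ⊗ₘ 𝟙 (𝟙_ M)) ≫ (λ_ (𝟙_ M)).hom = (λ_ (𝟙_ M)).hom ≫ 𝟙 (𝟙_ M)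
      simp
  | n + 1, X, X', Y, Y', f, g => by
      have ih := tensTensor_naturality (fun i => f i.castSucc) (fun i => g i.castSucc)
      have key : ∀ {A A' B B' C C' D D' E E' : M} {a : A ⟶ A'} {b : B ⟶ B'} {c : C ⟶ C'}
          {d : D ⟶ D'} {e : E ⟶ E'} {s : A ⊗ C ⟶ E} {s' : A' ⊗ C' ⟶ E'},
          (a ⊗ₘ c) ≫ s' = s ≫ e →
          ((a ⊗ₘ b) ⊗ₘ (c ⊗ₘ d)) ≫ tensorμ A' B' C' D' ≫ s' ▷ (B' ⊗ D') =
            (tensorμ A B C D ≫ s ▷ (B ⊗ D)) ≫ (e ⊗ₘ (b ⊗ₘ d)) := by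
        intro A A' B B' C C' D D' E E' a b c d e s s' h
        rw [tensorμ_natural_assoc, Category.assoc, ← tensorHom_id, ← tensorHom_id,
          tensorHom_comp_tensorHom, tensorHom_comp_tensorHom, h, Category.comp_id,
          Category.id_comp]
      exact key ih

theorem tensExtract_naturality : {n : ℕ} → {X Y : Fin (n + 1) → M} → (f : ∀ i, X i ⟶ Y i) →
    (p : Fin (n + 1)) → tensMap f ≫ (tensExtract Y p).hom = (tensExtract X p).hom ≫
      (tensMap (fun j => f (p.succAbove j)) ⊗ₘ f p)
  | 0, X, Y, f, p => by
      obtain rfl : p = Fin.last 0 := Fin.ext (by omega)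
      exact (Category.comp_id (tensMap f)).trans (Category.id_comp (tensMap f)).symm
  | n + 1, X, Y, f, p => by
      by_cases h : p = Fin.last (n + 1)
      · subst h
        have key : ∀ {p q : Fin (n + 1) → Fin (n + 2)} (a : Fin (n + 2)), p = q → ∀ e e',
            (tensMap (fun i => f (p i)) ⊗ₘ f a) ≫
              eqToHom (e : (tens (fun i => Y (p i)) ⊗ Y a) = (tens (fun i => Y (q i)) ⊗ Y a)) =
            eqToHom (e' : (tens (fun i => X (p i)) ⊗ X a) = (tens (fun i => X (q i)) ⊗ X a)) ≫
              (tensMap (fun i => f (q i)) ⊗ₘ f a) := by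
          rintro p q a rfl e e'
          simp
        have hd : ∀ Z : Fin (n + 2) → M, ∃ e, (tensExtract Z (Fin.last (n + 1))).hom =
            eqToHom (e : (tens (fun i => Z (Fin.castSucc i)) ⊗ Z (Fin.last (n + 1))) =
              (tens (fun i => Z ((Fin.last (n + 1)).succAbove i)) ⊗ Z (Fin.last (n + 1)))) := by
          intro Z
          refine ⟨by simp only [Fin.succAbove_last], ?_⟩
          rw [tensExtract, dif_pos rfl]
          rfl
        obtain ⟨e, he⟩ := hd X
        obtain ⟨e', he'⟩ := hd Y
        rw [he, he']
        exact key _ (funext fun i => (Fin.succAbove_last_apply i).symm) _ _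
      · have ih := tensExtract_naturality (fun i => f i.castSucc) (p.castPred h)
        have key : ∀ {p q : Fin n → Fin (n + 2)} {a b c d : Fin (n + 2)}, p = q → a = b → c = d →
            ∀ e e', ((tensMap (fun i => f (p i)) ⊗ₘ f a) ⊗ₘ f c) ≫
              eqToHom (e : ((tens (fun i => Y (p i)) ⊗ Y a) ⊗ Y c) =
                ((tens (fun i => Y (q i)) ⊗ Y b) ⊗ Y d)) =
            eqToHom (e' : ((tens (fun i => X (p i)) ⊗ X a) ⊗ X c) =
                ((tens (fun i => X (q i)) ⊗ X b) ⊗ X d)) ≫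
              ((tensMap (fun i => f (q i)) ⊗ₘ f b) ⊗ₘ f d) := by
          rintro p q a b c d rfl rfl rfl e e'
          simp
        have hp : (fun j => ((p.castPred h).succAbove j).castSucc) =
            fun j : Fin n => p.succAbove j.castSucc := funext fun j => by
          obtain ⟨q, rfl⟩ := Fin.exists_castSucc_eq.2 h
          simp only [Fin.castPred_castSucc, Fin.castSucc_succAbove_castSucc]
        have hl : Fin.last (n + 1) = p.succAbove (Fin.last n) :=
          (Fin.succAbove_ne_last_last h).symm
        have hc : (p.castPred h).castSucc = p := Fin.castSucc_castPred p h
        have hd : ∀ Z : Fin (n + 2) → M, ∃ e, (tensExtract Z p).hom =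
            (tensExtract (fun i => Z i.castSucc) (p.castPred h)).hom ▷ Z (Fin.last (n + 1)) ≫
              (α_ _ _ _).hom ≫ _ ◁ (β_ _ _).hom ≫ (α_ _ _ _).inv ≫
              eqToHom (e : ((tens (fun j => Z ((p.castPred h).succAbove j).castSucc) ⊗
                  Z (Fin.last (n + 1))) ⊗ Z (p.castPred h).castSucc) =
                ((tens (fun j => Z (p.succAbove j.castSucc)) ⊗ Z (p.succAbove (Fin.last n))) ⊗
                  Z p)) := by
          intro Z
          refine ⟨by simp only [congrFun hp, ← hl, hc], ?_⟩
          rw [tensExtract, dif_neg h]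
          rfl
        obtain ⟨e, he⟩ := hd X
        obtain ⟨e', he'⟩ := hd Y
        rw [he, he']
        have key' : ∀ {A A' B B' C C' D D' E E' : M} {a : A ⟶ A'} {b : B ⟶ B'} {c : C ⟶ C'}
            {d : D ⟶ D'} {w : E ⟶ E'} {s : A ⟶ C ⊗ D} {s' : A' ⟶ C' ⊗ D'}
            {t : (C ⊗ B) ⊗ D ⟶ E} {t' : (C' ⊗ B') ⊗ D' ⟶ E'},
            a ≫ s' = s ≫ (c ⊗ₘ d) → ((c ⊗ₘ b) ⊗ₘ d) ≫ t' = t ≫ w →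
            (a ⊗ₘ b) ≫ s' ▷ B' ≫ (α_ _ _ _).hom ≫ C' ◁ (β_ D' B').hom ≫ (α_ _ _ _).inv ≫ t' =
            (s ▷ B ≫ (α_ _ _ _).hom ≫ C ◁ (β_ D B).hom ≫ (α_ _ _ _).inv ≫ t) ≫ w := by
          intro A A' B B' C C' D D' E E' a b c d w s s' t t' h1 h2
          simp only [Category.assoc, ← h2]
          rw [← tensorHom_id s', tensorHom_comp_tensorHom_assoc, h1, Category.comp_id,
            ← associator_inv_naturality_assoc, ← id_tensorHom C (β_ D B).hom,
            tensorHom_comp_tensorHom_assoc, ← BraidedCategory.braiding_naturality,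
            Category.id_comp, ← id_tensorHom C',  ← tensorHom_id s B]
          rw [← Category.comp_id c, ← tensorHom_comp_tensorHom_assoc c, ← associator_naturality_assoc,
            tensorHom_comp_tensorHom_assoc, Category.id_comp, Category.comp_id]
        exact key' ih (key hp hl hc e' e)

theorem tensPerm_naturality : {n : ℕ} → (σ : Equiv.Perm (Fin n)) → {X Y : Fin n → M} →
    (f : ∀ i, X i ⟶ Y i) → tensMap f ≫ (tensPerm σ Y).hom =
      (tensPerm σ X).hom ≫ tensMap (fun i => f (σ i))
  | 0, _, _, _, _ => (Category.comp_id (𝟙 (𝟙_ M))).trans (Category.id_comp (𝟙 (𝟙_ M))).symm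
  | n + 1, σ, X, Y, f => by
      have h1 := tensExtract_naturality f (σ (Fin.last n))
      have h2 := tensPerm_naturality (permInit σ) (fun j => f ((σ (Fin.last n)).succAbove j))
      have h3 := tensCongr_naturality f (funext fun j => succAbove_permInit σ j)
      have key : ∀ {A A' B B' C C' D D' E E' : M} {a : A ⟶ A'} {b : B ⟶ B'} {c : C ⟶ C'}
          {d : D ⟶ D'} {w : E ⟶ E'} {s : A ⟶ B ⊗ C} {s' : A' ⟶ B' ⊗ C'} {t : B ⟶ D} {t' : B' ⟶ D'}
          {r : D ⟶ E} {r' : D' ⟶ E'}, a ≫ s' = s ≫ (b ⊗ₘ c) → b ≫ t' = t ≫ d →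
          d ≫ r' = r ≫ w → a ≫ s' ≫ (t' ≫ r') ▷ C' = (s ≫ (t ≫ r) ▷ C) ≫ (w ⊗ₘ c) := by
        intro A A' B B' C C' D D' E E' a b c d w s s' t t' r r' h1 h2 h3
        rw [reassoc_of% h1, ← tensorHom_id, ← tensorHom_id, Category.assoc,
          tensorHom_comp_tensorHom, tensorHom_comp_tensorHom, reassoc_of% h2, h3,
          Category.comp_id, Category.id_comp, Category.assoc]
      exact key h1 h2 h3

theorem regroup_naturality (Q : M) {n : ℕ} (X : Fin n → M) (k : Fin n → ℕ)
    {Y Y' : Fin (∑ i, k i) → M} (f : ∀ i, Y i ⟶ Y' i) :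
    (Q ◁ tensMap (fun i => X i ◁ tensMap (fun j => f (blk k i j)))) ≫ (regroup Q X k Y').hom =
      (regroup Q X k Y).hom ≫ ((Q ⊗ tens X) ◁ tensMap f) := by
  have h1 := tensTensor_naturality (fun i => 𝟙 (X i)) (fun i => tensMap (fun j => f (blk k i j)))
  have h2 := tensSigma_naturality k f
  rw [tensMap_id] at h1
  simp only [id_tensorHom] at h1
  -- `regroup` uses the inverses of `tensTensor` and `tensSigma`, so both naturality squares are
  -- inverted.
  rw [← Iso.inv_comp_eq, ← Category.assoc, ← Iso.eq_comp_inv] at h1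
  rw [← Iso.inv_comp_eq, ← Category.assoc, ← Iso.eq_comp_inv] at h2
  simp only [regroup, Iso.trans_hom, whiskerLeftIso_hom, Iso.symm_hom, Category.assoc]
  rw [← whiskerLeft_comp_assoc, ← Category.assoc (tensMap _), ← h1, Category.assoc,
    ← whiskerLeft_comp, ← h2, tensor_whiskerLeft]
  simp

end Naturality

/-! ### Diagrams of algebras as algebras of an endofunctor -/

section RawAlgebra

variable {M : Type u} [Category.{v} M] [MonoidalCategory M] [HasColimits M]

/-- The endofunctor of `D ⥤ M` given objectwise by `X ↦ ∐ₙ 𝒫(n) ⊗ X^{⊗ n}`. -/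
noncomputable abbrev diagramFunctor (D : Type v) [SmallCategory D] (op : ℕ → M) :
    (D ⥤ M) ⥤ (D ⥤ M) :=
  (Functor.whiskeringRight D M M).obj (operationFunctor op)

/-- A diagram of objects with operations parametrized by the objects `op n`, not subject to any
equations. -/
abbrev RawAlgebra (D : Type v) [SmallCategory D] (op : ℕ → M) :=
  Endofunctor.Algebra (diagramFunctor D op)

variable {C D : Type v} [SmallCategory C] [SmallCategory D] {op : ℕ → M}

namespace RawAlgebra

/-- The components of the structure map. -/
noncomputable def strApp (B : RawAlgebra D op) (d : D) :
    (operationFunctor op).obj (B.a.obj d) ⟶ B.a.obj d :=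
  B.str.app d

/-- The operations of arity `n`. -/
noncomputable def act (B : RawAlgebra D op) (d : D) (n : ℕ) :
    op n ⊗ tpow (B.a.obj d) n ⟶ B.a.obj d :=
  operationι op n (B.a.obj d) ≫ B.strApp d

theorem act_naturality (B : RawAlgebra D op) {d d' : D} (f : d ⟶ d') (n : ℕ) :
    B.act d n ≫ B.a.map f = (op n ◁ tpowMap (B.a.map f) n) ≫ B.act d' n := by
  have h : (operationFunctor op).map (B.a.map f) ≫ B.strApp d' = B.strApp d ≫ B.a.map f :=
    B.str.naturality f
  rw [act, act, Category.assoc, ← h, reassoc_of% @operationι_map]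

theorem act_hom {B T : RawAlgebra D op} (g : B ⟶ T) (d : D) (n : ℕ) :
    B.act d n ≫ g.f.app d = (op n ◁ tpowMap (g.f.app d) n) ≫ T.act d n := by
  have h : (operationFunctor op).map (g.f.app d) ≫ T.strApp d = B.strApp d ≫ g.f.app d :=
    congr_app g.h d
  rw [act, act, Category.assoc, ← h, reassoc_of% @operationι_map]

/-- Constructor from the operations of every arity. -/
noncomputable def mk' (X : D ⥤ M) (a : ∀ d n, op n ⊗ tpow (X.obj d) n ⟶ X.obj d)
    (ha : ∀ {d d' : D} (f : d ⟶ d') (n : ℕ),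
      a d n ≫ X.map f = (op n ◁ tpowMap (X.map f) n) ≫ a d' n) : RawAlgebra D op where
  a := X
  str :=
    { app := fun d => operationDesc op (a d)
      naturality := fun d d' f => by
        change (operationFunctor op).map (X.map f) ≫ operationDesc op (a d') =
          operationDesc op (a d) ≫ X.map f
        refine operation_hom_ext op fun n => ?_
        rw [reassoc_of% @operationι_map, operationι_desc, reassoc_of% @operationι_desc, ha] }

theorem mk'_act (X : D ⥤ M) (a : ∀ d n, op n ⊗ tpow (X.obj d) n ⟶ X.obj d)
    (ha : ∀ {d d' : D} (f : d ⟶ d') (n : ℕ),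
      a d n ≫ X.map f = (op n ◁ tpowMap (X.map f) n) ≫ a d' n) (d : D) (n : ℕ) :
    (mk' X a ha).act d n = a d n :=
  operationι_desc op (a d) n

/-- Constructor for homomorphisms. -/
noncomputable def homMk {B T : RawAlgebra D op} (g : B.a ⟶ T.a)
    (h : ∀ d n, B.act d n ≫ g.app d = (op n ◁ tpowMap (g.app d) n) ≫ T.act d n) : B ⟶ T :=
  { f := g
    h := by
      ext d
      change (operationFunctor op).map (g.app d) ≫ T.strApp d = B.strApp d ≫ g.app d
      refine operation_hom_ext op fun n => ?_
      rw [reassoc_of% @operationι_map]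
      exact (h d n).symm.trans (Category.assoc _ _ _) }

/-- Left Kan extension along `F` moves the generators from `C` to `D`; then the free algebra on the
extended diagram is taken. -/
theorem exists_free [SymmetricCategory M] [MonoidalClosed M] (F : C ⥤ D) (X : C ⥤ M) :
    ∃ (B : RawAlgebra D op) (u : X ⟶ F ⋙ B.a), ∀ (T : RawAlgebra D op) (f : X ⟶ F ⋙ T.a),
      ∃! g : B ⟶ T, u ≫ Functor.whiskerLeft F g.f = f := by
  have : IsSifted ℕ := IsFiltered.isSifted
  let adj := F.lanAdjunction M
  obtain ⟨B, η, h⟩ := exists_free_algebra (diagramFunctor D op) (F.lan.obj X)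
  refine ⟨B, adj.homEquiv _ _ η, fun T f => ?_⟩
  have e : ∀ g : B ⟶ T, adj.homEquiv _ _ η ≫ Functor.whiskerLeft F g.f = f ↔
      η ≫ g.f = (adj.homEquiv _ _).symm f := fun g => by
    rw [Equiv.eq_symm_apply, adj.homEquiv_naturality_right]
    rfl
  simp only [e]
  exact h T _

/-- Evaluation at `d i` has a left adjoint, so a family of relations at various objects amounts to a
single parallel pair out of a coproduct of diagrams. -/
theorem exists_quotient [SymmetricCategory M] [MonoidalClosed M] (B : RawAlgebra D op)
    {ι : Type v} (d : ι → D) (S : ι → M) (s t : ∀ i, S i ⟶ B.a.obj (d i)) :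
    ∃ (Q : RawAlgebra D op) (q : B ⟶ Q), (∀ d, Epi (q.f.app d)) ∧
      (∀ i, s i ≫ q.f.app (d i) = t i ≫ q.f.app (d i)) ∧
      ∀ (T : RawAlgebra D op) (g : B ⟶ T),
        (∀ i, s i ≫ g.f.app (d i) = t i ≫ g.f.app (d i)) → ∃ g' : Q ⟶ T, q ≫ g' = g := by
  have : IsSifted ℕ := IsFiltered.isSifted
  let adj := fun i => evaluationAdjunctionRight M (d i)
  let G : ι → (D ⥤ M) := fun i => (evaluationLeftAdjoint M (d i)).obj (S i)
  let m : (∀ i, S i ⟶ B.a.obj (d i)) → (∐ G ⟶ B.a) := fun s =>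
    Sigma.desc fun i => ((adj i).homEquiv _ _).symm (s i)
  have e : ∀ (Y : D ⥤ M) (g : B.a ⟶ Y), m s ≫ g = m t ≫ g ↔
      ∀ i, s i ≫ g.app (d i) = t i ≫ g.app (d i) := by
    intro Y g
    have e' : ∀ (s : ∀ i, S i ⟶ B.a.obj (d i)) i, Sigma.ι G i ≫ m s ≫ g =
        ((adj i).homEquiv _ _).symm (s i ≫ g.app (d i)) := fun s i => by
      rw [Sigma.ι_desc_assoc]
      exact ((adj i).homEquiv_naturality_right_symm (s i) g).symm
    constructor
    · intro h i
      have h' := congrArg (fun k => Sigma.ι G i ≫ k) h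
      simp only [e'] at h'
      exact ((adj i).homEquiv _ _).symm.injective h'
    · intro h
      refine Sigma.hom_ext _ _ fun i => ?_
      rw [e', e', h]
  obtain ⟨Q, q, hq, -, hst, hu⟩ := exists_quotient_algebra B (m s) (m t)
  refine ⟨Q, q, fun d => inferInstance, (e _ _).1 hst, fun T g hg => hu T g ((e _ _).2 hg)⟩

end RawAlgebra

end RawAlgebra

/-! ### The equations of algebras over an operad -/

section Equations

variable {M : Type u} [Category.{v} M] [MonoidalCategory M]

/-- The composite of an operation of arity `2` with morphisms into its two arguments. -/
def binop {Q : M} (r : 𝟙_ M ⟶ Q) {X X₁ X₂ : M} (a : Q ⊗ tpow X 2 ⟶ X) (f₁ : X₁ ⟶ X)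
    (f₂ : X₂ ⟶ X) : 𝟙_ M ⊗ (X₁ ⊗ X₂) ⟶ X :=
  (r ⊗ₘ (f₁ ⊗ₘ f₂)) ≫ (Q ◁ ((λ_ X).inv ▷ X)) ≫ a

theorem binop_naturality {Q : M} (r : 𝟙_ M ⟶ Q) {X X₁ X₂ Y Y₁ Y₂ : M} {a : Q ⊗ tpow X 2 ⟶ X}
    {b : Q ⊗ tpow Y 2 ⟶ Y} {f₁ : X₁ ⟶ X} {f₂ : X₂ ⟶ X} {g₁ : Y₁ ⟶ Y} {g₂ : Y₂ ⟶ Y}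
    {h : X ⟶ Y} {h₁ : X₁ ⟶ Y₁} {h₂ : X₂ ⟶ Y₂} (ha : a ≫ h = (Q ◁ tpowMap h 2) ≫ b)
    (e₁ : f₁ ≫ h = h₁ ≫ g₁) (e₂ : f₂ ≫ h = h₂ ≫ g₂) :
    binop r a f₁ f₂ ≫ h = (𝟙_ M ◁ (h₁ ⊗ₘ h₂)) ≫ binop r b g₁ g₂ := by
  have e' : (λ_ X).inv ▷ X ≫ ((𝟙 (𝟙_ M) ⊗ₘ h) ⊗ₘ h) = (h ⊗ₘ h) ≫ (λ_ Y).inv ▷ Y := by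
    rw [← tensorHom_id, ← tensorHom_id, tensorHom_comp_tensorHom, tensorHom_comp_tensorHom,
      id_tensorHom, leftUnitor_inv_naturality, Category.comp_id, Category.id_comp]
  have e'' : (r ⊗ₘ (f₁ ⊗ₘ f₂)) ≫ (Q ◁ (h ⊗ₘ h)) =
      (𝟙_ M ◁ (h₁ ⊗ₘ h₂)) ≫ (r ⊗ₘ (g₁ ⊗ₘ g₂)) := by
    rw [← id_tensorHom, ← id_tensorHom, tensorHom_comp_tensorHom, tensorHom_comp_tensorHom,
      tensorHom_comp_tensorHom, tensorHom_comp_tensorHom, e₁, e₂, Category.comp_id,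
      Category.id_comp]
  have key : ∀ (a : Q ⊗ ((𝟙_ M ⊗ X) ⊗ X) ⟶ X) (b : Q ⊗ ((𝟙_ M ⊗ Y) ⊗ Y) ⟶ Y),
      a ≫ h = (Q ◁ ((𝟙 (𝟙_ M) ⊗ₘ h) ⊗ₘ h)) ≫ b →
      ((r ⊗ₘ (f₁ ⊗ₘ f₂)) ≫ (Q ◁ ((λ_ X).inv ▷ X)) ≫ a) ≫ h =
        (𝟙_ M ◁ (h₁ ⊗ₘ h₂)) ≫ (r ⊗ₘ (g₁ ⊗ₘ g₂)) ≫ (Q ◁ ((λ_ Y).inv ▷ Y)) ≫ b := by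
    intro a b ha
    simp only [Category.assoc, ha]
    rw [← whiskerLeft_comp_assoc, e', whiskerLeft_comp_assoc, reassoc_of% e'']
  exact key a b ha

/-- Tensoring on either side is a left adjoint, hence preserves epimorphisms. -/
theorem epi_tensorHom [SymmetricCategory M] [MonoidalClosed M] {X Y X' Y' : M} (f : X ⟶ Y)
    (g : X' ⟶ Y') [Epi f] [Epi g] : Epi (f ⊗ₘ g) := by
  have hl : ∀ Z : M, (tensorLeft Z).IsLeftAdjoint := fun Z => (ihom.adjunction Z).isLeftAdjoint
  have hr : ∀ Z : M, (tensorRight Z).IsLeftAdjoint := fun Z =>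
    Functor.isLeftAdjoint_of_iso (BraidedCategory.tensorLeftIsoTensorRight Z)
  rw [MonoidalCategory.tensorHom_def]
  have h1 : Epi (f ▷ X') := inferInstanceAs (Epi ((tensorRight X').map f))
  have h2 : Epi (Y ◁ g) := inferInstanceAs (Epi ((tensorLeft Y).map g))
  exact epi_comp _ _

theorem epi_whiskerLeft [SymmetricCategory M] [MonoidalClosed M] (Z : M) {X Y : M} (f : X ⟶ Y)
    [Epi f] : Epi (Z ◁ f) := by
  rw [← id_tensorHom]
  exact epi_tensorHom _ _

theorem epi_tensMap [SymmetricCategory M] [MonoidalClosed M] : ∀ {n : ℕ} {X Y : Fin n → M}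
    (f : ∀ i, X i ⟶ Y i) [∀ i, Epi (f i)], Epi (tensMap f)
  | 0, _, _, _, _ => inferInstanceAs (Epi (𝟙 (𝟙_ M)))
  | _ + 1, _, _, f, _ => by
      have := epi_tensMap (fun i => f i.castSucc)
      exact epi_tensorHom (tensMap fun i => f i.castSucc) (f (Fin.last _))

variable [SymmetricCategory M]

/-- The index set of the equations of an algebra over an operad. -/
inductive AlgEq : Type
  | assoc (n : ℕ) (k : Fin n → ℕ)
  | unit
  | perm (n : ℕ) (σ : Equiv.Perm (Fin n))

namespace AlgEq

/-- The source of the two sides of an equation. -/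
def src (P : Operad M) (X : M) : AlgEq → M
  | assoc n k => P.op n ⊗ tens (fun i => P.op (k i) ⊗ tpow X (k i))
  | unit => 𝟙_ M ⊗ X
  | perm n _ => P.op n ⊗ tpow X n

/-- The left-hand side of an equation. -/
def lhs (P : Operad M) {X : M} (a : ∀ n, P.op n ⊗ tpow X n ⟶ X) : ∀ e : AlgEq, e.src P X ⟶ X
  | assoc n k => (P.op n ◁ tensMap (fun i => a (k i))) ≫ a n
  | unit => (P.one ⊗ₘ (λ_ X).inv) ≫ a 1
  | perm _ σ => (P.act σ ⊗ₘ (tensPerm σ (fun _ => X)).hom) ≫ a _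

/-- The right-hand side of an equation. -/
def rhs (P : Operad M) {X : M} (a : ∀ n, P.op n ⊗ tpow X n ⟶ X) : ∀ e : AlgEq, e.src P X ⟶ X
  | assoc n k => (regroup (P.op n) (fun i => P.op (k i)) k (fun _ => X)).hom ≫
        (P.comp k ▷ tpow X (∑ i, k i)) ≫ a (∑ i, k i)
  | unit => (λ_ X).hom
  | perm n _ => a n

/-- The functoriality of the sources of the equations. -/
def srcMap (P : Operad M) {X Y : M} (f : X ⟶ Y) : ∀ e : AlgEq, e.src P X ⟶ e.src P Y
  | assoc n k => P.op n ◁ tensMap (fun i => P.op (k i) ◁ tpowMap f (k i))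
  | unit => 𝟙_ M ◁ f
  | perm n _ => P.op n ◁ tpowMap f n

theorem epi_srcMap [MonoidalClosed M] (P : Operad M) {X Y : M} (f : X ⟶ Y) [Epi f] :
    ∀ e : AlgEq, Epi (e.srcMap P f)
  | assoc n k => by
      have : ∀ i, Epi (P.op (k i) ◁ tpowMap f (k i)) := fun i => by
        have := epi_tensMap (fun _ : Fin (k i) => f)
        exact epi_whiskerLeft _ _
      have := epi_tensMap (fun i => P.op (k i) ◁ tpowMap f (k i))
      exact epi_whiskerLeft _ _
  | unit => epi_whiskerLeft _ _
  | perm n _ => by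
      have := epi_tensMap (fun _ : Fin n => f)
      exact epi_whiskerLeft (P.op n) (tpowMap f n)

section

variable (P : Operad M) {X Y : M} {a : ∀ n, P.op n ⊗ tpow X n ⟶ X}
  {b : ∀ n, P.op n ⊗ tpow Y n ⟶ Y} {f : X ⟶ Y}
  (h : ∀ n, a n ≫ f = (P.op n ◁ tpowMap f n) ≫ b n)
include h

/-- With `rhs_naturality` and `epi_srcMap`, this transfers equations along an epimorphism of raw
algebras: they hold in the target once they hold after composing with it. -/
theorem lhs_naturality : ∀ e : AlgEq, e.lhs P a ≫ f = e.srcMap P f ≫ e.lhs P b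
  | assoc n k => by
      change ((P.op n ◁ tensMap (fun i => a (k i))) ≫ a n) ≫ f =
        (P.op n ◁ tensMap (fun i => P.op (k i) ◁ tpowMap f (k i))) ≫
          (P.op n ◁ tensMap (fun i => b (k i))) ≫ b n
      rw [Category.assoc, h, ← whiskerLeft_comp_assoc, ← whiskerLeft_comp_assoc, ← tensMap_comp,
        ← tensMap_comp]
      simp only [h]
  | unit => by
      have key : ∀ {Q : M} (r : 𝟙_ M ⟶ Q) (a : Q ⊗ (𝟙_ M ⊗ X) ⟶ X) (b : Q ⊗ (𝟙_ M ⊗ Y) ⟶ Y),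
          a ≫ f = (Q ◁ (𝟙 (𝟙_ M) ⊗ₘ f)) ≫ b →
          ((r ⊗ₘ (λ_ X).inv) ≫ a) ≫ f = (𝟙_ M ◁ f) ≫ (r ⊗ₘ (λ_ Y).inv) ≫ b := by
        intro Q r a b h
        rw [Category.assoc, h, id_tensorHom, ← id_tensorHom Q, ← id_tensorHom _ f,
          tensorHom_comp_tensorHom_assoc, tensorHom_comp_tensorHom_assoc, id_tensorHom,
          leftUnitor_inv_naturality, Category.comp_id, Category.id_comp]
      exact key P.one (a 1) (b 1) (h 1)
  | perm n σ => by
      change ((P.act σ ⊗ₘ (tensPerm σ (fun _ => X)).hom) ≫ a n) ≫ f =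
        (P.op n ◁ tpowMap f n) ≫ (P.act σ ⊗ₘ (tensPerm σ (fun _ => Y)).hom) ≫ b n
      rw [Category.assoc, h, ← id_tensorHom, tensorHom_comp_tensorHom_assoc,
        tensorHom_comp_tensorHom_assoc, Category.comp_id, Category.id_comp,
        tensPerm_naturality σ (fun _ => f)]

theorem rhs_naturality : ∀ e : AlgEq, e.rhs P a ≫ f = e.srcMap P f ≫ e.rhs P b
  | assoc n k => by
      change ((regroup (P.op n) (fun i => P.op (k i)) k (fun _ => X)).hom ≫
          (P.comp k ▷ tpow X (∑ i, k i)) ≫ a (∑ i, k i)) ≫ f =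
        (P.op n ◁ tensMap (fun i => P.op (k i) ◁ tpowMap f (k i))) ≫
          (regroup (P.op n) (fun i => P.op (k i)) k (fun _ => Y)).hom ≫
            (P.comp k ▷ tpow Y (∑ i, k i)) ≫ b (∑ i, k i)
      have e := regroup_naturality (P.op n) (fun i => P.op (k i)) k (fun _ => f)
      rw [reassoc_of% e, whisker_exchange_assoc, ← h]
      simp only [Category.assoc]
  | unit => (leftUnitor_naturality f).symm
  | perm n _ => h n

end

end AlgEq

end Equations

/-! ### Left adjoints of pullback functors between field theories -/

section Diagram

variable {M : Type u} [Category.{v} M] [MonoidalCategory M]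

theorem tpowMap_id (X : M) (n : ℕ) : tpowMap (𝟙 X) n = 𝟙 (tpow X n) :=
  tensMap_id _

theorem whiskerLeft_tpowMap_comp (Q : M) {X Y Z T : M} (f : X ⟶ Y) (g : Y ⟶ Z) (n : ℕ)
    (a : Q ⊗ tpow Z n ⟶ T) :
    (Q ◁ tpowMap (f ≫ g) n) ≫ a = (Q ◁ tpowMap f n) ≫ (Q ◁ tpowMap g n) ≫ a := by
  rw [← whiskerLeft_comp_assoc]
  exact congrArg (fun t => Q ◁ t ≫ a) (tensMap_comp _ _)

variable [SymmetricCategory M]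

/-- The forgetful functor from algebras over an operad. -/
@[simps]
def algForget (P : Operad M) : Alg P ⥤ M where
  obj A := A.carrier
  map f := f.hom
  map_id _ := rfl
  map_comp _ _ := rfl

variable {C D : Type v} [SmallCategory C] [SmallCategory D] {P : Operad M}

theorem diagram_hom_ext {A B : D ⥤ Alg P} {f g : A ⟶ B}
    (h : ∀ d, (f.app d).hom = (g.app d).hom) : f = g :=
  NatTrans.ext (funext fun d => AlgHom.ext (h d))

theorem binaryOp_naturality {A B : D ⥤ Alg P} (t : A ⟶ B) (r : 𝟙_ M ⟶ P.op 2) {c₁ c₂ c : D}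
    (f₁ : c₁ ⟶ c) (f₂ : c₂ ⟶ c) :
    binaryOp A r f₁ f₂ ≫ (t.app c).hom =
      (𝟙_ M ◁ ((t.app c₁).hom ⊗ₘ (t.app c₂).hom)) ≫ binaryOp B r f₁ f₂ :=
  binop_naturality r ((t.app c).comm 2) (congrArg AlgHom.hom (t.naturality f₁))
    (congrArg AlgHom.hom (t.naturality f₂))

/-- Shows that the field theory condition is stable under composition, as an orthogonality relation
must be. Postcomposition uses that `A.map g` commutes with the binary action. -/
theorem binaryOp_comp (A : D ⥤ Alg P) (r : 𝟙_ M ⟶ P.op 2) {b₁ b₂ c₁ c₂ c d : D} (g : c ⟶ d)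
    (f₁ : c₁ ⟶ c) (f₂ : c₂ ⟶ c) (h₁ : b₁ ⟶ c₁) (h₂ : b₂ ⟶ c₂) :
    binaryOp A r (h₁ ≫ f₁ ≫ g) (h₂ ≫ f₂ ≫ g) =
      (𝟙_ M ◁ ((A.map h₁).hom ⊗ₘ (A.map h₂).hom)) ≫ binaryOp A r f₁ f₂ ≫ (A.map g).hom := by
  have e : ∀ {b c : D} (h : b ⟶ c) (f : c ⟶ d),
      (A.map (h ≫ f)).hom = (A.map h).hom ≫ (A.map f).hom := fun h f => by
    rw [A.map_comp]
    rfl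
  have e₁ : binaryOp A r f₁ f₂ ≫ (A.map g).hom = binaryOp A r (f₁ ≫ g) (f₂ ≫ g) := by
    refine (binop_naturality r (g₁ := (A.map (f₁ ≫ g)).hom) (g₂ := (A.map (f₂ ≫ g)).hom)
      (h₁ := 𝟙 _) (h₂ := 𝟙 _) ((A.map g).comm 2) ?_ ?_).trans ?_
    · rw [e, Category.id_comp]
    · rw [e, Category.id_comp]
    · rw [id_tensorHom_id, whiskerLeft_id, Category.id_comp]
      rfl
  rw [e₁]
  have e₂ := binop_naturality r (a := (A.obj d).action 2) (b := (A.obj d).action 2)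
    (f₁ := (A.map (h₁ ≫ f₁ ≫ g)).hom) (f₂ := (A.map (h₂ ≫ f₂ ≫ g)).hom)
    (g₁ := (A.map (f₁ ≫ g)).hom) (g₂ := (A.map (f₂ ≫ g)).hom) (h := 𝟙 _)
    (h₁ := (A.map h₁).hom) (h₂ := (A.map h₂).hom)
    (by rw [tpowMap_id, whiskerLeft_id, Category.id_comp, Category.comp_id])
    (by rw [e, Category.comp_id]) (by rw [e, Category.comp_id])
  rw [Category.comp_id] at e₂
  exact e₂

namespace RawAlgebra

variable [HasColimits M]

/-- The raw algebra underlying a diagram of algebras over an operad. -/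
noncomputable def ofDiagram (T : D ⥤ Alg P) : RawAlgebra D P.op :=
  mk' (T ⋙ algForget P) (fun d n => (T.obj d).action n) (fun f n => (T.map f).comm n)

theorem ofDiagram_act (T : D ⥤ Alg P) (d : D) (n : ℕ) :
    (ofDiagram T).act d n = (T.obj d).action n :=
  mk'_act _ _ (fun f n => (T.map f).comm n) d n

theorem lhs_ofDiagram_eq_rhs (T : D ⥤ Alg P) (d : D) :
    ∀ e : AlgEq, e.lhs P ((ofDiagram T).act d) = e.rhs P ((ofDiagram T).act d) := by
  have h : (ofDiagram T).act d = (T.obj d).action := funext (ofDiagram_act T d)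
  rw [h]
  rintro (⟨n, k⟩ | _ | ⟨n, σ⟩)
  · exact (T.obj d).action_comp k
  · exact (T.obj d).action_one
  · exact (T.obj d).action_perm σ

variable (Q : RawAlgebra D P.op) (hQ : ∀ d (e : AlgEq), e.lhs P (Q.act d) = e.rhs P (Q.act d))

/-- A raw algebra which satisfies the equations is a diagram of algebras. -/
noncomputable def toDiagram : D ⥤ Alg P where
  obj d :=
    { carrier := Q.a.obj d
      action := Q.act d
      action_comp := fun k => hQ d (.assoc _ k)
      action_one := hQ d .unit
      action_perm := fun σ => hQ d (.perm _ σ) }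
  map f := ⟨Q.a.map f, Q.act_naturality f⟩
  map_id d := AlgHom.ext (Q.a.map_id d)
  map_comp f g := AlgHom.ext (Q.a.map_comp f g)

variable {Q hQ}

/-- Homomorphisms of raw algebras are natural transformations of diagrams of algebras. -/
noncomputable def toDiagramHom {T : D ⥤ Alg P} (g : Q ⟶ ofDiagram T) : toDiagram Q hQ ⟶ T where
  app d := ⟨g.f.app d, fun n =>
    (act_hom g d n).trans (congrArg (_ ≫ ·) (ofDiagram_act T d n))⟩
  naturality _ _ f := AlgHom.ext (g.f.naturality f)

/-- Natural transformations of diagrams of algebras are homomorphisms of raw algebras. -/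
noncomputable def ofDiagramHom {T : D ⥤ Alg P} (k : toDiagram Q hQ ⟶ T) : Q ⟶ ofDiagram T :=
  homMk
    { app := fun d => (k.app d).hom
      naturality := fun _ _ f => congrArg AlgHom.hom (k.naturality f) }
    fun d n => by
      rw [ofDiagram_act]
      exact (k.app d).comm n

end RawAlgebra

end Diagram

/-! ### The left adjoint by generators and relations. -/

section LeftAdjoint

variable {M : Type u} [Category.{v} M] [MonoidalCategory M] [SymmetricCategory M]
  {C D : Type v} [SmallCategory C] [SmallCategory D]

/-- The relations imposed on the free raw algebra to obtain the left adjoint of a pullback functor: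
the equations of an algebra, the relations of a field theory, and the relations which make the
unit a homomorphism. -/
inductive FTRel (C : Type v) (oD : Orthogonality D) : Type v
  | alg (d : D) (e : AlgEq)
  | perp {c₁ c₂ c : D} (f₁ : c₁ ⟶ c) (f₂ : c₂ ⟶ c) (h : oD.perp f₁ f₂)
  | unit (c : C) (n : ℕ)

theorem isRightAdjoint_of_exists_universal {E E' : Type*} [Category* E] [Category* E']
    (R : E ⥤ E') (h : ∀ A : E', ∃ (B : E) (η : A ⟶ R.obj B), ∀ (T : E) (f : A ⟶ R.obj T),
      ∃! g : B ⟶ T, η ≫ R.map g = f) : R.IsRightAdjoint := by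
  have : ∀ A, HasInitial (StructuredArrow A R) := fun A => by
    obtain ⟨B, η, hη⟩ := h A
    refine (IsInitial.ofUniqueHom (X := StructuredArrow.mk η)
      (fun T => StructuredArrow.homMk (hη T.right T.hom).choose
        (hη T.right T.hom).choose_spec.1) fun T m => ?_).hasInitial
    refine StructuredArrow.ext _ _ ((hη T.right T.hom).choose_spec.2 _ ?_)
    exact StructuredArrow.w m
  exact isRightAdjointOfStructuredArrowInitials R

-- The free raw algebra on the objects underlying `A` is divided by the relations `FTRel`. A map
-- from `A` to the pullback of a field theory `T` extends uniquely to the free raw algebra, and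
-- respects the relations because `T` satisfies them and the map is a homomorphism.
open RawAlgebra in
theorem pullback_isRightAdjoint [MonoidalClosed M] [HasColimits M] {oC : Orthogonality C}
    {oD : Orthogonality D} (P : BipointedOperad M) (F : C ⥤ D) (hF : IsOrthogonal oC oD F) :
    (pullback P F hF).IsRightAdjoint := by
  refine isRightAdjoint_of_exists_universal _ fun A => ?_
  obtain ⟨B, u, hB⟩ := RawAlgebra.exists_free (op := P.op) F (A.obj ⋙ algForget P.toOperad)
  let u' : ∀ c, (A.obj.obj c).carrier ⟶ B.a.obj (F.obj c) := fun c => u.app c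
  let tgt : FTRel C oD → D
    | .alg d _ => d
    | .perp (c := c) _ _ _ => c
    | .unit c _ => F.obj c
  let S : FTRel C oD → M
    | .alg d e => e.src P.toOperad (B.a.obj d)
    | .perp (c₁ := c₁) (c₂ := c₂) _ _ _ => 𝟙_ M ⊗ (B.a.obj c₁ ⊗ B.a.obj c₂)
    | .unit c n => P.op n ⊗ tpow (A.obj.obj c).carrier n
  let s : ∀ i, S i ⟶ B.a.obj (tgt i)
    | .alg d e => e.lhs P.toOperad (B.act d)
    | .perp (c := c) f₁ f₂ _ => binop P.r₁ (B.act c 2) (B.a.map f₁) (B.a.map f₂)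
    | .unit c n => (A.obj.obj c).action n ≫ u' c
  let t : ∀ i, S i ⟶ B.a.obj (tgt i)
    | .alg d e => e.rhs P.toOperad (B.act d)
    | .perp (c := c) f₁ f₂ _ => binop P.r₂ (B.act c 2) (B.a.map f₁) (B.a.map f₂)
    | .unit c n => (P.op n ◁ tpowMap (u' c) n) ≫ B.act (F.obj c) n
  obtain ⟨Q, q, hq, hst, hQ⟩ := B.exists_quotient tgt S s t
  have hbin : ∀ {T : RawAlgebra D P.op} (g : B ⟶ T) (r : 𝟙_ M ⟶ P.op 2) {c₁ c₂ c : D}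
      (f₁ : c₁ ⟶ c) (f₂ : c₂ ⟶ c),
      binop r (B.act c 2) (B.a.map f₁) (B.a.map f₂) ≫ g.f.app c =
        (𝟙_ M ◁ (g.f.app c₁ ⊗ₘ g.f.app c₂)) ≫
          binop r (T.act c 2) (T.a.map f₁) (T.a.map f₂) := fun g r c₁ c₂ c f₁ f₂ =>
    binop_naturality r (act_hom g c 2) (g.f.naturality f₁) (g.f.naturality f₂)
  -- The relations only equate the images of the two sides formed in `B`; cancelling the epimorphism
  -- induced on sources gives the equation in `Q`.
  have hQe : ∀ d (e : AlgEq), e.lhs P.toOperad (Q.act d) = e.rhs P.toOperad (Q.act d) := by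
    intro d e
    have := AlgEq.epi_srcMap P.toOperad (q.f.app d) e
    rw [← cancel_epi (e.srcMap P.toOperad (q.f.app d)),
      ← AlgEq.lhs_naturality P.toOperad (act_hom q d),
      ← AlgEq.rhs_naturality P.toOperad (act_hom q d)]
    exact hst (.alg d e)
  have hQf : IsFieldTheory oD P (toDiagram Q hQe) := by
    intro c₁ c₂ c f₁ f₂ h
    have := epi_tensorHom (q.f.app c₁) (q.f.app c₂)
    have := epi_whiskerLeft (𝟙_ M) (q.f.app c₁ ⊗ₘ q.f.app c₂)
    refine (cancel_epi (𝟙_ M ◁ (q.f.app c₁ ⊗ₘ q.f.app c₂))).1 ?_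
    exact (hbin q P.r₁ f₁ f₂).symm.trans ((hst (.perp f₁ f₂ h)).trans (hbin q P.r₂ f₁ f₂))
  let η : A.obj ⟶ F ⋙ toDiagram Q hQe :=
    { app := fun c => ⟨u' c ≫ q.f.app (F.obj c), fun n =>
        (Category.assoc _ _ _).symm.trans ((hst (.unit c n)).trans
          ((Category.assoc _ _ _).trans ((congrArg (_ ≫ ·) (act_hom q (F.obj c) n)).trans
            (whiskerLeft_tpowMap_comp _ (u' c) (q.f.app (F.obj c)) n _).symm)))⟩
      naturality := fun c c' f => AlgHom.ext
        ((u ≫ Functor.whiskerLeft F q.f).naturality f) }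
  refine ⟨⟨toDiagram Q hQe, hQf⟩, ObjectProperty.homMk η, fun T f => ?_⟩
  have hT : ∀ g : B ⟶ ofDiagram T.obj, (∀ c, u' c ≫ g.f.app (F.obj c) = (f.hom.app c).hom) →
      ∀ i, s i ≫ g.f.app (tgt i) = t i ≫ g.f.app (tgt i) := by
    rintro g hg (⟨d, e⟩ | ⟨f₁, f₂, h⟩ | ⟨c, n⟩)
    · refine (AlgEq.lhs_naturality P.toOperad (act_hom g d) e).trans
        (Eq.trans ?_ (AlgEq.rhs_naturality P.toOperad (act_hom g d) e).symm)
      rw [lhs_ofDiagram_eq_rhs]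
    · refine (hbin g P.r₁ f₁ f₂).trans (Eq.trans ?_ (hbin g P.r₂ f₁ f₂).symm)
      rw [ofDiagram_act]
      exact congrArg (_ ≫ ·) (T.property f₁ f₂ h)
    · have e := act_hom g (F.obj c) n
      rw [ofDiagram_act] at e
      have e' := whiskerLeft_tpowMap_comp (P.op n) (u' c) (g.f.app (F.obj c)) n
        ((T.obj.obj (F.obj c)).action n)
      refine (Category.assoc _ _ _).trans (Eq.trans ?_ (Category.assoc _ _ _).symm)
      refine (congrArg (_ ≫ ·) (hg c)).trans (((f.hom.app c).comm n).trans ?_)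
      refine Eq.trans ?_ (congrArg (_ ≫ ·) e).symm
      refine Eq.trans ?_ e'
      exact congrArg (fun k => (P.op n ◁ tpowMap k n) ≫ _) (hg c).symm
  let f' : A.obj ⋙ algForget P.toOperad ⟶ F ⋙ (ofDiagram T.obj).a :=
    Functor.whiskerRight f.hom (algForget P.toOperad)
  obtain ⟨g, hg, hgu⟩ := hB (ofDiagram T.obj) f'
  obtain ⟨g', hg'⟩ := hQ _ g (hT g fun c => congr_app hg c)
  refine ⟨ObjectProperty.homMk (toDiagramHom g'), ?_, fun k hk => ?_⟩
  · refine ObjectProperty.hom_ext _ (diagram_hom_ext fun c => ?_)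
    have e : q.f ≫ g'.f = g.f := congrArg Endofunctor.Algebra.Hom.f hg'
    change (u' c ≫ q.f.app (F.obj c)) ≫ g'.f.app (F.obj c) = _
    refine (Category.assoc _ _ _).trans ?_
    refine (congrArg (u' c ≫ ·) (congr_app e (F.obj c))).trans (congr_app hg c)
  -- Uniqueness: freeness of `B` determines the composite with `q`, and `q` is objectwise an
  -- epimorphism.
  · have e : q ≫ ofDiagramHom k.hom = g := hgu _ <| by
      ext c
      have := congrArg AlgHom.hom (congr_app (congrArg InducedCategory.Hom.hom hk) c)
      exact (Category.assoc _ _ _).symm.trans this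
    have e' : q ≫ ofDiagramHom k.hom = q ≫ g' := e.trans hg'.symm
    refine ObjectProperty.hom_ext _ (diagram_hom_ext fun d => ?_)
    have := hq d
    exact (cancel_epi (q.f.app d)).1 (congr_app (congrArg Endofunctor.Algebra.Hom.f e') d)

end LeftAdjoint

/-! ### Field theories on an orthogonal localization. -/

section Localization

variable {M : Type u} [Category.{v} M] [MonoidalCategory M] [SymmetricCategory M]
  {C D : Type v} [SmallCategory C] [SmallCategory D]

/-- The largest orthogonality relation for which a diagram of algebras is a field theory. -/
def inducedOrthogonality (P : BipointedOperad M) (A : D ⥤ Alg P.toOperad) : Orthogonality D where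
  -- Both orders are required to force symmetry: exchanging the arguments replaces each operation by
  -- its permuted version, which is a different condition.
  perp _ _ _ f₁ f₂ := binaryOp A P.r₁ f₁ f₂ = binaryOp A P.r₂ f₁ f₂ ∧
    binaryOp A P.r₁ f₂ f₁ = binaryOp A P.r₂ f₂ f₁
  symm _ _ _ _ _ h := h.symm
  comp _ _ _ _ _ _ _ _ _ _ _ h := by
    simp only [binaryOp_comp, h.1, h.2, and_self]

theorem isFieldTheory_of_iso {oC : Orthogonality C} {P : BipointedOperad M}
    {A B : C ⥤ Alg P.toOperad} (e : A ≅ B) (hA : IsFieldTheory oC P A) :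
    IsFieldTheory oC P B := by
  intro c₁ c₂ c f₁ f₂ h
  have h' : ∀ r, binaryOp B r f₁ f₂ =
      (𝟙_ M ◁ ((e.inv.app c₁).hom ⊗ₘ (e.inv.app c₂).hom)) ≫ binaryOp A r f₁ f₂ ≫
        (e.hom.app c).hom := by
    intro r
    have hc : (e.inv.app c).hom ≫ (e.hom.app c).hom = 𝟙 _ :=
      congrArg AlgHom.hom (e.inv_hom_id_app c)
    rw [← Category.assoc, ← binaryOp_naturality, Category.assoc, hc, Category.comp_id]
  rw [h', h', hA f₁ f₂ h]

/-- Minimality of the pushforward is applied to the relation induced by `B`; symmetry of `oC`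
provides its second half. -/
theorem isFieldTheory_pushforward {oC : Orthogonality C} {P : BipointedOperad M} (F : C ⥤ D)
    (B : D ⥤ Alg P.toOperad) (hB : IsFieldTheory oC P (F ⋙ B)) :
    IsFieldTheory (oC.pushforward F) P B := fun _ _ _ _ _ h =>
  (h (inducedOrthogonality P B) fun _ _ _ f₁ f₂ h' =>
    ⟨hB f₁ f₂ h', hB f₂ f₁ (oC.symm f₁ f₂ h')⟩).1

variable (oC : Orthogonality C) (P : BipointedOperad M) (W : MorphismProperty C) (L : C ⥤ D)
  [L.IsLocalization W]

include W in
theorem locPullback_full : (locPullback oC P L).Full := by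
  have := Localization.full_whiskeringLeft L W (Alg P.toOperad)
  have : ((IsFieldTheory (oC.pushforward L) P).ι ⋙
      (Functor.whiskeringLeft C D (Alg P.toOperad)).obj L).Full := inferInstance
  have e : locPullback oC P L ⋙ (IsFieldTheory oC P).ι ≅
      (IsFieldTheory (oC.pushforward L) P).ι ⋙
        (Functor.whiskeringLeft C D (Alg P.toOperad)).obj L := Iso.refl _
  exact Functor.Full.of_comp_faithful_iso e

include W in
theorem locPullback_faithful : (locPullback oC P L).Faithful := by
  have := Localization.faithful_whiskeringLeft L W (Alg P.toOperad)
  have : ((IsFieldTheory (oC.pushforward L) P).ι ⋙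
      (Functor.whiskeringLeft C D (Alg P.toOperad)).obj L).Faithful := inferInstance
  have e : locPullback oC P L ⋙ (IsFieldTheory oC P).ι ≅
      (IsFieldTheory (oC.pushforward L) P).ι ⋙
        (Functor.whiskeringLeft C D (Alg P.toOperad)).obj L := Iso.refl _
  exact Functor.Faithful.of_comp_iso e

/-- The universal property of `L` produces the preimage as a functor, and
`isFieldTheory_pushforward` makes it a field theory. -/
theorem isWConstant_iff_mem_essImage (A : FT oC P) :
    IsWConstant oC P W A ↔ (locPullback oC P L).essImage A := by
  constructor
  · intro hA
    have hW : W.IsInvertedBy A.obj := fun _ _ f hf => hA f hf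
    let e : L ⋙ Localization.lift A.obj hW L ≅ A.obj := Localization.fac A.obj hW L
    exact ⟨⟨Localization.lift A.obj hW L, isFieldTheory_pushforward L _
      (isFieldTheory_of_iso e.symm A.property)⟩, ⟨ObjectProperty.isoMk _ e⟩⟩
  · rintro ⟨B, ⟨e⟩⟩ c c' f hf
    have h1 : IsIso (((locPullback oC P L).obj B).obj.map f) :=
      isWConstant_locPullback oC P W L B f hf
    have e' := (IsFieldTheory oC P).ι.mapIso e
    exact (NatIso.isIso_map_iff e' f).1 h1

end Localization

end FieldTheory

open FieldTheory in
theorem proposition4p5 {M : Type u} [Category.{v} M] [MonoidalCategory M] [SymmetricCategory M]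
    [MonoidalClosed M] [HasLimits M] [HasColimits M]
    (P : BipointedOperad M)
    {C D : Type v} [SmallCategory C] [SmallCategory D] (oC : Orthogonality C)
    (W : MorphismProperty C) (L : C ⥤ D) [L.IsLocalization W] :
    (locPullback oC P L).IsRightAdjoint ∧
    ∀ (Lsh : FT oC P ⥤ FT (oC.pushforward L) P) (adj : Lsh ⊣ locPullback oC P L),
      (IsIso (restrictedAdjunction oC P W L adj).unit ∧
        IsIso (restrictedAdjunction oC P W L adj).counit) ∧
      ∀ A : FT oC P, IsWConstant oC P W A ↔ IsIso (adj.unit.app A) := by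
  refine ⟨pullback_isRightAdjoint P L _, fun Lsh adj => ?_⟩
  have := locPullback_full oC P W L
  have := locPullback_faithful oC P W L
  have hW : ∀ A : FT oC P, IsWConstant oC P W A ↔ IsIso (adj.unit.app A) := fun A =>
    (isWConstant_iff_mem_essImage oC P W L A).trans adj.isIso_unit_app_iff_mem_essImage.symm
  have : (locPullbackW oC P W L).Full := inferInstanceAs ((IsWConstant oC P W).lift _ _).Full
  have : (locPullbackW oC P W L).Faithful :=
    inferInstanceAs ((IsWConstant oC P W).lift _ _).Faithful
  -- The restricted right adjoint is still fully faithful, so its counit is invertible. For the unit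
  -- it remains to see that it is essentially surjective.
  refine ⟨⟨?_, inferInstance⟩, hW⟩
  refine @NatIso.isIso_of_isIso_app _ _ _ _ _ _ _ fun A => ?_
  rw [Adjunction.isIso_unit_app_iff_mem_essImage]
  obtain ⟨B, ⟨e⟩⟩ := (isWConstant_iff_mem_essImage oC P W L A.obj).1 A.property
  exact ⟨B, ⟨ObjectProperty.isoMk _ e⟩⟩
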